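/- Let $k$ be an arbitrary field, let $R=k[X_1,\ldots,X_n]$, and let $q_1,q_2,q_3\in R$ be homogeneous polynomials of degree $2$ which minimally generate an ideal $J=(q_1,q_2,q_3)$ of height at most $2$ (minimally: no two of the $q_i$ generate $J$). Then at least one of the following holds: (a) There are $8$ (not necessarily distinct, possibly zero) linear forms $l_1,\ldots,l_8\in R$ such that $q_1,q_2,q_3\in k[l_1,\ldots,l_8]$. (b) After replacing the given quadrics by suitable minimal generators of the same ideal, two of them share a common linear factor; that is, there are homogeneous polynomials $q_1',q_2',q_3'$ of degree $2$ which minimally generate $J$ and a nonzero linear form $z\in R$ dividing both $q_1'$ and $q_2'$. -/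

import Mathlib

/-- The elements `f i` form a minimal system of generators of the ideal `I`: they generate it, and
the ideal generated by the remaining ones is different from `I` whenever one of them is left out. -/
def MinimallyGenerates {R ι : Type*} [CommRing R] (f : ι → R) (I : Ideal R) : Prop :=
  Ideal.span (Set.range f) = I ∧ ∀ j, Ideal.span (f '' {i | i ≠ j}) ≠ I

/-- The polynomials `q i` can be expressed entirely in terms of `m` linear forms: they lie in
`k[l₁, …, lₘ]` for some linear forms `l₁, …, lₘ` (not necessarily independent or nonzero, so that
this means "at most `m`"). -/
def ExpressibleInLinearForms {k σ ι : Type*} [Field k] (q : ι → MvPolynomial σ k) (m : ℕ) : Prop :=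
  ∃ l : Fin m → MvPolynomial σ k, (∀ j, (l j).IsHomogeneous 1) ∧
    ∀ i, q i ∈ Algebra.adjoin k (Set.range l)

/-- `f` and `g` share a common linear factor: a nonzero linear form divides both. -/
def ShareLinearFactor {k σ : Type*} [Field k] (f g : MvPolynomial σ k) : Prop :=
  ∃ z : MvPolynomial σ k, z.IsHomogeneous 1 ∧ z ≠ 0 ∧ z ∣ f ∧ z ∣ g

/-! Both outcomes come from a linear syzygy `∑ mᵢ qᵢ = 0`. If the `mᵢ` are independent, they can
serve as variables, and Koszul exactness writes the `qᵢ` in six linear forms. If they are dependent,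
a change of generators removes one coefficient; since linear forms are prime, `m₀ q₀' + m₁ q₁' = 0`
forces a common linear factor (`HasLinearSyzygy.expressible_or_shareLinearFactor`).

To find a syzygy, pass to the algebraic closure, where the quadrics lie in a prime `P` of height at
most two (`hasLinearSyzygy_or_inTwoLinearForms`). If `P` contains a linear form `x`, then modulo `x`
the quadrics lie in a principal prime `(f)`. For `f` of degree two, a pencil of combinations is
divisible by `x`, which gives a syzygy; for `f` linear, the quadrics lie in `(x, f)`. If `P`
contains no linear form, the Nullstellensatz gives a zero of `P` that is not a vertex of every
quadric. Projection from it reads `qᵢ = X lᵢ + gᵢ`, and the elimination ideal is again some `(f)`.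
The minors of `(l, g)` are cubics divisible by `f`, which is not linear, so `l × g` divided by `f`
is a syzygy of degree at most one. If all minors vanish, `lᵢ qⱼ = lⱼ qᵢ` already is one.

It remains to return to `k`. Linear syzygies solve a linear system over `k`, so they descend. If the
quadrics lie in `(x, y)` over the closure, with cofactors `aᵢ`, `bᵢ`, they involve only eight linear
forms, and their stacked polar matrices, defined over `k`, have rank at most eight. Either a kernel
vector on which `x` or `y` is nonzero yields a syzygy, or the quadrics are invariant under
translation by the kernel and are expressible over `k` in as many forms as the rank. -/

open MvPolynomial

/-- There is a nontrivial syzygy of `q` whose coefficients are linear forms. -/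
def HasLinearSyzygy {K σ : Type*} [Field K] (q : Fin 3 → MvPolynomial σ K) : Prop :=
  ∃ m : Fin 3 → MvPolynomial σ K, (∀ i, (m i).IsHomogeneous 1) ∧ m ≠ 0 ∧ ∑ i, m i * q i = 0

/-- The `q i` lie, with linear cofactors, in the ideal generated by two linear forms. -/
def InTwoLinearForms {K σ : Type*} [Field K] (q : Fin 3 → MvPolynomial σ K) : Prop :=
  ∃ (x y : MvPolynomial σ K) (a b : Fin 3 → MvPolynomial σ K), x.IsHomogeneous 1 ∧
    y.IsHomogeneous 1 ∧ (∀ i, (a i).IsHomogeneous 1) ∧ (∀ i, (b i).IsHomogeneous 1) ∧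
    ∀ i, q i = x * a i + y * b i

/-! ### Producing linear syzygies -/

section LinearSyzygy

variable {K σ τ : Type*} [Field K]

theorem MvPolynomial.IsHomogeneous.mul_C {p : MvPolynomial σ K} {n : ℕ} (hp : p.IsHomogeneous n)
    (c : K) : (p * C c).IsHomogeneous n := by
  rw [mul_comm]; exact hp.C_mul c

theorem MvPolynomial.IsHomogeneous.map_algHom {p : MvPolynomial σ K} {n : ℕ}
    (hp : p.IsHomogeneous n) {φ : MvPolynomial σ K →ₐ[K] MvPolynomial τ K}
    (hφ : ∀ s, (φ (X s)).IsHomogeneous 1) : (φ p).IsHomogeneous n := by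
  rw [aeval_unique φ]
  simpa only [one_mul, Function.comp_def] using hp.aeval _ hφ

theorem hasLinearSyzygy_of_linear_relation [Nonempty σ] {q : Fin 3 → MvPolynomial σ K}
    {c : Fin 3 → K} (hc : c ≠ 0) (h : ∑ i, C (c i) * q i = 0) : HasLinearSyzygy q := by
  obtain ⟨s⟩ := ‹Nonempty σ›
  refine ⟨fun i => X s * C (c i), fun i => (isHomogeneous_X K s).mul_C _, ?_, ?_⟩
  · intro h0
    apply hc
    funext i
    have := congrFun h0 i
    simpa using this
  · simp only [mul_assoc, ← Finset.mul_sum, h, mul_zero]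

theorem exists_perp_pair (r : Fin 3 → K) : ∃ c d : Fin 3 → K, (∑ i, c i * r i = 0) ∧
    (∑ i, d i * r i = 0) ∧ ∃ i j, c i * d j - c j * d i ≠ 0 := by
  by_cases h0 : r 0 = 0
  · by_cases h1 : r 1 = 0
    · refine ⟨![1, 0, 0], ![0, 1, 0], ?_, ?_, 0, 1, ?_⟩ <;> simp [Fin.sum_univ_three, h0, h1]
    · refine ⟨![1, 0, 0], ![0, - r 2, r 1], ?_, ?_, 0, 2, ?_⟩ <;>
        (simp [Fin.sum_univ_three, h0, h1]; try ring)
  · refine ⟨![- r 1, r 0, 0], ![- r 2, 0, r 0], ?_, ?_, 1, 2, ?_⟩ <;>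
      simp [Fin.sum_univ_three, h0] <;> ring

/-- The condition on `c` leaves at least a plane. Two independent members of it give combinations `z
B` and `z D`, and `B (z D) - D (z B) = 0` is the syzygy. A nonzero minor of the two coefficient
vectors keeps it nontrivial unless `B = 0`, when a constant relation is available. -/
theorem hasLinearSyzygy_of_pencil [Nonempty σ] {q b : Fin 3 → MvPolynomial σ K}
    {z : MvPolynomial σ K} (r : Fin 3 → K) (hb : ∀ i, (b i).IsHomogeneous 1)
    (h : ∀ c : Fin 3 → K, ∑ i, c i * r i = 0 →
      ∑ i, C (c i) * q i = z * ∑ i, C (c i) * b i) : HasLinearSyzygy q := by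
  obtain ⟨c, d, hc, hd, i, j, hij⟩ := exists_perp_pair r
  set B := ∑ i, C (c i) * b i with hB
  set D := ∑ i, C (d i) * b i with hD
  have hc0 : c ≠ 0 := by rintro rfl; simp at hij
  have hBh : B.IsHomogeneous 1 := IsHomogeneous.sum _ _ _ fun i _ => (hb i).C_mul _
  have hDh : D.IsHomogeneous 1 := IsHomogeneous.sum _ _ _ fun i _ => (hb i).C_mul _
  by_cases hB0 : B = 0
  · refine hasLinearSyzygy_of_linear_relation hc0 ?_
    rw [h c hc, ← hB, hB0, mul_zero]
  refine ⟨fun i => B * C (d i) - D * C (c i), fun i => (hBh.mul_C _).sub (hDh.mul_C _), ?_, ?_⟩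
  · intro h0
    have hi := congrFun h0 i
    have hj := congrFun h0 j
    simp only [Pi.zero_apply] at hi hj
    have : B * C (c i * d j - c j * d i) = 0 := by
      simp only [map_sub, map_mul]
      linear_combination C (c i) * hj - C (c j) * hi
    rcases mul_eq_zero.1 this with h1 | h1
    · exact hB0 h1
    · exact hij (C_eq_zero.1 h1)
  · have h1 := h c hc
    have h2 := h d hd
    simp only [sub_mul, Finset.sum_sub_distrib, mul_assoc, ← Finset.mul_sum, h1, h2]
    ring

theorem HasLinearSyzygy.map {q : Fin 3 → MvPolynomial σ K} (h : HasLinearSyzygy q)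
    (φ : MvPolynomial σ K →ₐ[K] MvPolynomial τ K) (hinj : Function.Injective φ)
    (hφ : ∀ s, (φ (X s)).IsHomogeneous 1) : HasLinearSyzygy fun i => φ (q i) := by
  obtain ⟨m, hm, h0, hs⟩ := h
  have key : ∀ {p : MvPolynomial σ K} {n : ℕ}, p.IsHomogeneous n → (φ p).IsHomogeneous n :=
    fun hp => hp.map_algHom hφ
  refine ⟨fun i => φ (m i), fun i => key (hm i), ?_, ?_⟩
  · intro h
    apply h0
    funext i
    exact hinj (by simpa using congrFun h i)
  · simpa using congrArg φ hs

theorem InTwoLinearForms.map {q : Fin 3 → MvPolynomial σ K} (h : InTwoLinearForms q)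
    (φ : MvPolynomial σ K →ₐ[K] MvPolynomial τ K)
    (hφ : ∀ s, (φ (X s)).IsHomogeneous 1) : InTwoLinearForms fun i => φ (q i) := by
  obtain ⟨x, y, a, b, hx, hy, ha, hb, hq⟩ := h
  have key : ∀ {p : MvPolynomial σ K} {n : ℕ}, p.IsHomogeneous n → (φ p).IsHomogeneous n :=
    fun hp => hp.map_algHom hφ
  exact ⟨φ x, φ y, fun i => φ (a i), fun i => φ (b i), key hx, key hy, fun i => key (ha i),
    fun i => key (hb i), fun i => by simp [hq i]⟩

end LinearSyzygy

/-! ### Factors of homogeneous polynomials and division by a variable -/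

section Homogeneous

variable {K σ τ : Type*} [Field K]

theorem MvPolynomial.IsHomogeneous.order_coe {f : MvPolynomial σ K} {n : ℕ}
    (hf : f.IsHomogeneous n) (h0 : f ≠ 0) : (f : MvPowerSeries σ K).order = n := by
  apply le_antisymm
  · obtain ⟨d, hd⟩ := ne_zero_iff.1 h0
    have := MvPowerSeries.order_le (f := (f : MvPowerSeries σ K)) (d := d) (by simpa using hd)
    have h2 : d.degree = n := by
      by_contra hne
      exact hd (hf.coeff_eq_zero hne)
    rwa [h2] at this
  · apply MvPowerSeries.le_order
    intro d hd
    rw [coeff_coe]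
    apply hf.coeff_eq_zero
    intro h
    rw [h] at hd
    exact lt_irrefl _ hd

theorem MvPolynomial.order_coe_le {f : MvPolynomial σ K} (h0 : f ≠ 0) :
    (f : MvPowerSeries σ K).order ≤ f.totalDegree := by
  obtain ⟨d, hd⟩ := ne_zero_iff.1 h0
  have := MvPowerSeries.order_le (f := (f : MvPowerSeries σ K)) (d := d) (by simpa using hd)
  refine this.trans ?_
  have := le_totalDegree (mem_support_iff.2 hd)
  exact_mod_cast this

theorem MvPolynomial.isHomogeneous_of_order_coe {f : MvPolynomial σ K}
    (h : (f : MvPowerSeries σ K).order = f.totalDegree) : f.IsHomogeneous f.totalDegree := by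
  intro d hd
  rw [Pi.one_def, ← Finsupp.degree_eq_weight_one]
  apply le_antisymm
  · exact le_totalDegree (mem_support_iff.2 hd)
  · have := MvPowerSeries.order_le (f := (f : MvPowerSeries σ K)) (d := d) (by simpa using hd)
    rw [h] at this
    exact_mod_cast this

/-- The factors of a nonzero homogeneous polynomial are homogeneous. -/
theorem MvPolynomial.IsHomogeneous.of_mul {f g : MvPolynomial σ K} {n : ℕ}
    (h : (f * g).IsHomogeneous n) (h0 : f * g ≠ 0) :
    f.IsHomogeneous f.totalDegree ∧ g.IsHomogeneous g.totalDegree ∧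
      f.totalDegree + g.totalDegree = n := by
  have hf := left_ne_zero_of_mul h0
  have hg := right_ne_zero_of_mul h0
  have h1 := h.order_coe h0
  have h2 : f.totalDegree + g.totalDegree = n := by
    rw [← totalDegree_mul_of_isDomain hf hg, h.totalDegree h0]
  -- The lowest degrees (orders) and the highest degrees of the factors both add up to `n`, so they
  -- agree in each factor.
  rw [coe_mul, MvPowerSeries.order_mul] at h1
  have hf1 := order_coe_le hf
  have hg1 := order_coe_le hg
  obtain ⟨a, ha⟩ := ENat.ne_top_iff_exists.1 (ne_top_of_le_ne_top (ENat.natCast_ne_top _) hf1)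
  obtain ⟨b, hb⟩ := ENat.ne_top_iff_exists.1 (ne_top_of_le_ne_top (ENat.natCast_ne_top _) hg1)
  rw [← ha] at h1 hf1
  rw [← hb] at h1 hg1
  norm_cast at h1 hf1 hg1
  refine ⟨isHomogeneous_of_order_coe ?_, isHomogeneous_of_order_coe ?_, h2⟩
  · rw [← ha]; norm_cast; omega
  · rw [← hb]; norm_cast; omega

theorem MvPolynomial.IsHomogeneous.of_mul_left {f g : MvPolynomial σ K} {m n : ℕ}
    (h : (f * g).IsHomogeneous (m + n)) (hf : f.IsHomogeneous m) (h0 : f ≠ 0) :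
    g.IsHomogeneous n := by
  by_cases hg : g = 0
  · rw [hg]; exact isHomogeneous_zero _ _ _
  obtain ⟨-, h2, h3⟩ := h.of_mul (mul_ne_zero h0 hg)
  rw [hf.totalDegree h0] at h3
  have : g.totalDegree = n := by omega
  rwa [this] at h2

theorem MvPolynomial.X_none_dvd_sub_rename (p : MvPolynomial (Option τ) K) :
    X none ∣ p - rename some (aeval (fun o : Option τ => o.elim 0 X) p : MvPolynomial τ K) := by
  induction p using MvPolynomial.induction_on with
  | C a => simp
  | add p q hp hq =>
    simp only [map_add]
    convert dvd_add hp hq using 1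
    ring
  | mul_X p o hp =>
    simp only [map_mul, aeval_X]
    cases o with
    | none => simp
    | some t =>
      simp only [Option.elim_some, rename_X, ← sub_mul]
      exact hp.mul_right _

theorem MvPolynomial.IsHomogeneous.exists_eq_X_none_mul_add {p : MvPolynomial (Option τ) K} {n : ℕ}
    (hp : p.IsHomogeneous (n + 1)) : ∃ (m : MvPolynomial (Option τ) K) (g : MvPolynomial τ K),
      m.IsHomogeneous n ∧ g.IsHomogeneous (n + 1) ∧ p = X none * m + rename some g := by
  obtain ⟨m, hm⟩ := X_none_dvd_sub_rename p
  set g : MvPolynomial τ K := MvPolynomial.aeval (fun o : Option τ => o.elim 0 X) p with hg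
  have hgh : g.IsHomogeneous (n + 1) := by
    apply IsHomogeneous.map_algHom hp
    intro o
    rw [aeval_X]
    cases o with
    | none => exact isHomogeneous_zero _ _ _
    | some t => exact isHomogeneous_X _ _
  refine ⟨m, g, ?_, hgh, by rw [← hm]; ring⟩
  have h : (X none * m).IsHomogeneous (1 + n) := by
    rw [← hm, add_comm]
    exact MvPolynomial.IsHomogeneous.sub hp hgh.rename_isHomogeneous
  exact MvPolynomial.IsHomogeneous.of_mul_left h (isHomogeneous_X _ _) (X_ne_zero _)

end Homogeneous

/-! ### Linear forms and linear substitutions -/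

section LinearForms

variable {K σ τ υ : Type*} [Field K] [Fintype σ] [DecidableEq σ] [Fintype τ] [DecidableEq τ]
  [Fintype υ] [DecidableEq υ]

/-- The linear form with a given associated linear functional. -/
noncomputable def linForm (φ : Module.Dual K (σ → K)) : MvPolynomial σ K :=
  ∑ s, C (φ (Pi.single s 1)) * X s

theorem linForm_isHomogeneous (φ : Module.Dual K (σ → K)) : (linForm φ).IsHomogeneous 1 :=
  IsHomogeneous.sum _ _ _ fun s _ => (isHomogeneous_X K s).C_mul _

theorem eval_linForm (φ : Module.Dual K (σ → K)) (v : σ → K) : eval v (linForm φ) = φ v := by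
  have : v = ∑ s, v s • Pi.single s (1 : K) := pi_eq_sum_univ' v
  conv_rhs => rw [this]
  simp [linForm, mul_comm]

theorem linForm_proj (s : σ) : linForm (LinearMap.proj s : Module.Dual K (σ → K)) = X s := by
  simp [linForm, Pi.single_apply]

theorem linForm_sum_smul {ι : Type*} (u : Finset ι) (c : ι → K) (φ : ι → Module.Dual K (σ → K)) :
    linForm (∑ i ∈ u, c i • φ i) = ∑ i ∈ u, C (c i) * linForm (φ i) := by
  simp only [linForm, LinearMap.sum_apply, LinearMap.smul_apply, map_sum, Finset.sum_mul,
    Finset.mul_sum, smul_eq_mul, map_mul, mul_assoc]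
  exact Finset.sum_comm

theorem linForm_eq_zero {φ : Module.Dual K (σ → K)} : linForm φ = 0 ↔ φ = 0 := by
  constructor
  · intro h
    refine LinearMap.ext fun v => ?_
    rw [← eval_linForm, h, map_zero, LinearMap.zero_apply]
  · rintro rfl; simp [linForm]

theorem MvPolynomial.IsHomogeneous.exists_eq_linForm {p : MvPolynomial σ K}
    (hp : p.IsHomogeneous 1) : ∃ φ : Module.Dual K (σ → K), p = linForm φ := by
  refine ⟨∑ s, coeff (Finsupp.single s 1) p • LinearMap.proj s, ?_⟩
  rw [linForm_sum_smul]
  simp only [linForm_proj]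
  ext d
  by_cases hd : d.degree = 1
  · obtain ⟨t, rfl⟩ : d ∈ Set.range (fun t : σ => Finsupp.single t 1) := by
      rw [Finsupp.range_single_one]; exact hd
    simp [coeff_sum, coeff_C_mul, coeff_X, Finsupp.single_left_inj]
  · rw [hp.coeff_eq_zero hd, IsHomogeneous.coeff_eq_zero _ hd]
    exact IsHomogeneous.sum _ _ _ fun s _ => (isHomogeneous_X K s).C_mul _

/-- The substitution along a linear map: polynomial functions are pulled back. -/
noncomputable def coordHom (e : (σ → K) →ₗ[K] (τ → K)) : MvPolynomial τ K →ₐ[K] MvPolynomial σ K :=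
  aeval fun t => linForm (LinearMap.proj t ∘ₗ e)

omit [Fintype τ] [DecidableEq τ] in
theorem coordHom_X (e : (σ → K) →ₗ[K] (τ → K)) (t : τ) :
    coordHom e (X t) = linForm (LinearMap.proj t ∘ₗ e) := aeval_X _ _

omit [Fintype τ] [DecidableEq τ] in
theorem coordHom_X_isHomogeneous (e : (σ → K) →ₗ[K] (τ → K)) (t : τ) :
    (coordHom e (X t)).IsHomogeneous 1 := by
  rw [coordHom_X]; exact linForm_isHomogeneous _

theorem coordHom_linForm (e : (σ → K) →ₗ[K] (τ → K)) (φ : Module.Dual K (τ → K)) :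
    coordHom e (linForm φ) = linForm (φ ∘ₗ e) := by
  have h : φ ∘ₗ e = ∑ t, φ (Pi.single t 1) • (LinearMap.proj t ∘ₗ e) := by
    refine LinearMap.ext fun v => ?_
    rw [LinearMap.comp_apply, pi_eq_sum_univ' (e v)]
    simp [mul_comm]
  rw [h, linForm_sum_smul, linForm, map_sum]
  simp [coordHom_X, algHom_C]

omit [Fintype τ] [DecidableEq τ] in
theorem eval_coordHom (e : (σ → K) →ₗ[K] (τ → K)) (v : σ → K) (p : MvPolynomial τ K) :
    eval v (coordHom e p) = eval (e v) p := by
  induction p using MvPolynomial.induction_on with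
  | C a => simp [algHom_C]
  | add p q hp hq => simp [hp, hq]
  | mul_X p t hp => simp [hp, coordHom_X, eval_linForm]

omit [Fintype υ] [DecidableEq υ] in
theorem coordHom_comp (e : (σ → K) →ₗ[K] (τ → K)) (f : (τ → K) →ₗ[K] (υ → K)) :
    (coordHom e).comp (coordHom f) = coordHom (f ∘ₗ e) := by
  apply MvPolynomial.algHom_ext
  intro t
  simp [coordHom_X, coordHom_linForm, LinearMap.comp_assoc]

theorem coordHom_id : coordHom (LinearMap.id : (σ → K) →ₗ[K] (σ → K)) = AlgHom.id K _ := by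
  apply MvPolynomial.algHom_ext
  intro t
  simp [coordHom_X, linForm_proj]

/-- A linear change of coordinates. -/
noncomputable def coordEquiv (e : (σ → K) ≃ₗ[K] (τ → K)) :
    MvPolynomial τ K ≃ₐ[K] MvPolynomial σ K :=
  AlgEquiv.ofAlgHom (coordHom e.toLinearMap) (coordHom e.symm.toLinearMap)
    (by rw [coordHom_comp, ← coordHom_id]; simp) (by rw [coordHom_comp, ← coordHom_id]; simp)

theorem coordEquiv_apply (e : (σ → K) ≃ₗ[K] (τ → K)) (p : MvPolynomial τ K) :
    coordEquiv e p = coordHom e.toLinearMap p := rfl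

theorem coordEquiv_symm_apply (e : (σ → K) ≃ₗ[K] (τ → K)) (p : MvPolynomial σ K) :
    (coordEquiv e).symm p = coordHom e.symm.toLinearMap p := rfl

end LinearForms

/-! ### Adapted linear coordinates -/

section Coordinates

variable {K : Type*} [Field K]

/-- The coordinates of `f` are completed by those of the component in `ker f`, taken along `N`; the
latter vanish on `N`. -/
theorem exists_coordinates_of_isCompl {σ ι : Type*} [Finite σ] {f : (σ → K) →ₗ[K] (ι → K)}
    (hf : Function.Surjective f) {N : Submodule K (σ → K)} (hN : IsCompl (LinearMap.ker f) N) :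
    ∃ (d : ℕ) (e : (σ → K) ≃ₗ[K] (ι ⊕ Fin d → K)), (∀ v i, e v (Sum.inl i) = f v i) ∧
      ∀ v ∈ N, ∀ t, e v (Sum.inr t) = 0 := by
  let b := (Module.finBasis K (LinearMap.ker f)).equivFun
  let g := b.toLinearMap ∘ₗ Submodule.projectionOnto _ _ hN
  have hg : LinearMap.ker g = N := by
    rw [LinearMap.ker_comp_of_ker_eq_bot _ b.ker, Submodule.ker_projectionOnto]
  have hgs : LinearMap.range g = ⊤ := by
    rw [LinearMap.range_comp, Submodule.range_projectionOnto, Submodule.map_top, b.range]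
  let e := LinearMap.equivProdOfSurjectiveOfIsCompl f g (LinearMap.range_eq_top.2 hf) hgs
    (by rw [hg]; exact hN)
  refine ⟨_, e.trans (LinearEquiv.sumArrowLequivProdArrow _ _ K K).symm, fun v i => ?_,
    fun v hv t => ?_⟩
  · simp [e]
  · rw [← hg, LinearMap.mem_ker] at hv
    simp [e, hv]

/-- A nonzero functional vanishing on the range would be a linear relation among the `ξ i`. -/
theorem LinearIndependent.surjective_pi {V ι : Type*} [AddCommGroup V] [Module K V] [Fintype ι]
    [DecidableEq ι] {ξ : ι → Module.Dual K V} (hξ : LinearIndependent K ξ) :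
    Function.Surjective (LinearMap.pi ξ) := by
  rw [← LinearMap.range_eq_top]
  by_contra h
  obtain ⟨φ, hφ, hle⟩ := Submodule.exists_le_ker_of_lt_top _ (lt_top_iff_ne_top.2 h)
  apply hφ
  have h1 := Fintype.linearIndependent_iff.1 hξ (fun i => φ (Pi.single i 1)) (by
    ext v
    have : φ (LinearMap.pi ξ v) = 0 := hle (LinearMap.mem_range_self _ v)
    rw [pi_eq_sum_univ' (LinearMap.pi ξ v)] at this
    simpa [mul_comm] using this)
  apply LinearMap.pi_ext'
  intro i
  ext
  simpa using h1 i

theorem exists_coordinates_of_linearIndependent {σ ι : Type*} [Finite σ] [Fintype ι]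
    [DecidableEq ι] {ξ : ι → Module.Dual K (σ → K)} (hξ : LinearIndependent K ξ) :
    ∃ (d : ℕ) (e : (σ → K) ≃ₗ[K] (ι ⊕ Fin d → K)), ∀ v i, e v (Sum.inl i) = ξ i v := by
  obtain ⟨N, hN⟩ := Submodule.exists_isCompl (LinearMap.ker (LinearMap.pi ξ))
  obtain ⟨d, e, he, -⟩ := exists_coordinates_of_isCompl hξ.surjective_pi hN
  exact ⟨d, e, he⟩

theorem exists_coordinates_of_dual_ne_zero {σ : Type*} [Finite σ] {ξ : Module.Dual K (σ → K)}
    (hξ : ξ ≠ 0) : ∃ (d : ℕ) (e : (σ → K) ≃ₗ[K] (Option (Fin d) → K)), ∀ v, e v none = ξ v := by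
  obtain ⟨d, e, he⟩ := exists_coordinates_of_linearIndependent (ι := Unit) (ξ := fun _ => ξ)
    (LinearIndependent.of_subsingleton () hξ)
  let w : Option (Fin d) ≃ Unit ⊕ Fin d :=
    (Equiv.optionEquivSumPUnit (Fin d)).trans (Equiv.sumComm _ _)
  exact ⟨d, e.trans (LinearEquiv.funCongrLeft K K w), fun v => by
    simp [w, LinearEquiv.funCongrLeft_apply, LinearMap.funLeft_apply, he]⟩

theorem exists_coordinates_of_ne_zero {σ : Type*} [Finite σ] {p : σ → K} (hp : p ≠ 0) :
    ∃ (d : ℕ) (e : (σ → K) ≃ₗ[K] (Option (Fin d) → K)), e p none = 1 ∧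
      ∀ t, e p (some t) = 0 := by
  obtain ⟨s, hs⟩ := Function.ne_iff.1 hp
  rw [Pi.zero_apply] at hs
  let f : (σ → K) →ₗ[K] (Unit → K) := LinearMap.pi fun _ => (p s)⁻¹ • LinearMap.proj s
  have hf : ∀ v u, f v u = (p s)⁻¹ * v s := fun v u => by simp [f]
  have hfp : ∀ u, f p u = 1 := fun u => by rw [hf, inv_mul_cancel₀ hs]
  obtain ⟨d, e, he, he'⟩ := exists_coordinates_of_isCompl (f := f) (N := K ∙ p)
    (fun w => ⟨w () • p, by ext u; simp [hfp]⟩) (by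
      constructor
      · rw [Submodule.disjoint_def]
        intro v hv hvp
        obtain ⟨c, rfl⟩ := Submodule.mem_span_singleton.1 hvp
        have := congrFun (LinearMap.mem_ker.1 hv) ()
        simp [hfp] at this
        simp [this]
      · rw [codisjoint_iff_le_sup]
        intro v _
        rw [← sub_add_cancel v (f v () • p)]
        refine Submodule.add_mem_sup ?_ (Submodule.smul_mem _ _ (Submodule.mem_span_singleton_self p))
        rw [LinearMap.mem_ker]
        ext u
        simp [hfp])
  let w : Option (Fin d) ≃ Unit ⊕ Fin d :=
    (Equiv.optionEquivSumPUnit (Fin d)).trans (Equiv.sumComm _ _)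
  refine ⟨d, e.trans (LinearEquiv.funCongrLeft K K w), ?_, fun t => ?_⟩
  · simp [w, LinearEquiv.funCongrLeft_apply, LinearMap.funLeft_apply, he, hfp]
  · simp [w, LinearEquiv.funCongrLeft_apply, LinearMap.funLeft_apply,
      he' p (Submodule.mem_span_singleton_self p)]

end Coordinates

/-! ### Heights of primes and elimination of one variable -/

section Height

/-- In a factorial domain a nonzero prime ideal contains a prime element; `f = 0` accounts for
height zero. -/
theorem Ideal.eq_span_singleton_of_height_le_one {A : Type*} [CommRing A] [IsDomain A]
    [UniqueFactorizationMonoid A] (p : Ideal A) [hp : p.IsPrime] (h : p.height ≤ 1) :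
    ∃ f, p = Ideal.span {f} ∧ (f = 0 ∨ Prime f) := by
  by_cases h0 : p = ⊥
  · exact ⟨0, by simpa using h0, Or.inl rfl⟩
  obtain ⟨f, hf, hfp⟩ := hp.exists_mem_prime_of_ne_bot h0
  refine ⟨f, Ideal.eq_span_singleton_of_height_eq_one (le_antisymm h ?_) hf hfp, Or.inr hfp⟩
  rw [Order.one_le_iff_pos, pos_iff_ne_zero, Ne, Ideal.height_eq_zero_iff_eq_bot]
  exact h0

/-- Contraction undoes the extension of primes to the polynomial ring, so strict chains extend to
strict chains. -/
theorem Ideal.height_le_height_map_C {A : Type*} [CommRing A] (p : Ideal A) [hp : p.IsPrime] :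
    p.height ≤ (p.map (Polynomial.C : A →+* Polynomial A)).height := by
  have hP : (p.map (Polynomial.C : A →+* Polynomial A)).IsPrime := Ideal.isPrime_map_C_of_isPrime
  let F : PrimeSpectrum A → PrimeSpectrum (Polynomial A) :=
    fun P => ⟨P.asIdeal.map Polynomial.C, Ideal.isPrime_map_C_of_isPrime⟩
  have hF : StrictMono F := by
    have hcomap : ∀ P : PrimeSpectrum A,
        (P.asIdeal.map Polynomial.C).comap (Polynomial.C : A →+* Polynomial A) = P.asIdeal := by
      intro P
      ext a
      rw [Ideal.mem_comap, Ideal.mem_map_C_iff]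
      constructor
      · intro h; simpa using h 0
      · intro h n
        rw [Polynomial.coeff_C]
        split_ifs
        · exact h
        · exact zero_mem _
    apply Monotone.strictMono_of_injective
    · intro P Q h
      exact Ideal.map_mono h
    · intro P Q h
      have := congrArg (fun I : PrimeSpectrum (Polynomial A) => I.asIdeal.comap Polynomial.C) h
      simp only [F, hcomap] at this
      exact PrimeSpectrum.ext this
  have := Order.height_le_height_apply_of_strictMono F hF ⟨p, hp⟩
  rwa [← PrimeSpectrum.height_eq_orderHeight, ← PrimeSpectrum.height_eq_orderHeight] at this

/-- The coefficient `a` keeps the given element of `P` out of the extension of the contraction. That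
extension is thus a strictly smaller prime, and the height drops. -/
theorem Polynomial.height_comap_C_le_one {A : Type*} [CommRing A] (P : Ideal (Polynomial A))
    [hP : P.IsPrime] (h : P.height ≤ 2) {a b : A}
    (hab : Polynomial.X * Polynomial.C a + Polynomial.C b ∈ P) (ha : Polynomial.C a ∉ P) :
    (P.comap (Polynomial.C : A →+* Polynomial A)).height ≤ 1 := by
  set p := P.comap (Polynomial.C : A →+* Polynomial A) with hp
  have hPp : (p.map (Polynomial.C : A →+* Polynomial A)).IsPrime := Ideal.isPrime_map_C_of_isPrime
  have hlt : p.map (Polynomial.C : A →+* Polynomial A) < P := by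
    refine lt_of_le_of_ne Ideal.map_comap_le ?_
    intro heq
    rw [← heq, Ideal.mem_map_C_iff] at hab
    have := hab 1
    simp [Polynomial.coeff_C] at this
    exact ha this
  have h1 := (Ideal.height_add_one_le_of_lt_of_isPrime hlt).trans h
  have h2 := p.height_le_height_map_C
  have h3 : p.height + 1 ≤ 1 + 1 := (add_le_add_left h2 1).trans (h1.trans (by norm_num))
  exact (ENat.add_le_add_iff_right ENat.one_ne_top).1 h3

theorem MvPolynomial.comap_rename_some_eq_span_singleton {K τ : Type*} [Field K]
    (P : Ideal (MvPolynomial (Option τ) K)) [hP : P.IsPrime] (h : P.height ≤ 2)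
    {a b : MvPolynomial τ K} (hab : X none * rename some a + rename some b ∈ P)
    (ha : rename some a ∉ P) :
    ∃ f : MvPolynomial τ K, (f = 0 ∨ Prime f) ∧ ∀ g, rename some g ∈ P ↔ f ∣ g := by
  set Q := P.comap (optionEquivLeft K τ).symm.toRingEquiv with hQ
  have hQP : ∀ x, x ∈ P ↔ optionEquivLeft K τ x ∈ Q := by
    intro x
    simp [hQ, Ideal.mem_comap]
  have hren : ∀ x : MvPolynomial τ K, optionEquivLeft K τ (rename some x) = Polynomial.C x := by
    intro x
    induction x using MvPolynomial.induction_on with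
    | C a => simp [optionEquivLeft_C]
    | add p q hp hq => simp [hp, hq]
    | mul_X p t hp => simp [hp, optionEquivLeft_X_some]
  have hQh : Q.height ≤ 2 := by
    rw [hQ, RingEquiv.height_comap]; exact h
  have hQp : Q.IsPrime := Ideal.comap_isPrime _ _
  rw [hQP] at hab ha
  simp only [map_add, map_mul, hren, optionEquivLeft_X_none] at hab ha
  obtain ⟨f, hf, hf'⟩ := Ideal.eq_span_singleton_of_height_le_one _
    (Polynomial.height_comap_C_le_one Q hQh hab ha)
  refine ⟨f, hf', fun g => ?_⟩
  rw [hQP, hren, ← Ideal.mem_comap, hf, Ideal.mem_span_singleton]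

end Height

/-! ### Quadrics in a prime of height at most two -/

section HeightTwoPrime

variable {K τ : Type*} [Field K]

theorem MvPolynomial.IsHomogeneous.exists_eq_C {p : MvPolynomial τ K} (hp : p.IsHomogeneous 0) :
    ∃ c, p = C c :=
  ⟨_, totalDegree_eq_zero_iff_eq_C.1 ((totalDegree_zero_iff_isHomogeneous τ).2 hp)⟩

theorem Prime.totalDegree_ne_zero {f : MvPolynomial τ K} (hf : Prime f) : f.totalDegree ≠ 0 := by
  intro h
  rw [totalDegree_eq_zero_iff_eq_C] at h
  apply hf.not_isUnit
  rw [h]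
  refine IsUnit.map C (isUnit_iff_ne_zero.2 fun h0 => hf.ne_zero ?_)
  rw [h, h0, C_0]

/-- Modulo `X none` the quadrics are multiples of one prime `f`, of degree one or two unless all
residues vanish. In degree two the multipliers are constants `r i`, and the combinations killing `r`
are divisible by `X none`. -/
theorem hasLinearSyzygy_or_inTwoLinearForms_of_X_none_mem
    {q : Fin 3 → MvPolynomial (Option τ) K} (hq : ∀ i, (q i).IsHomogeneous 2)
    [Finite τ] (P : Ideal (MvPolynomial (Option τ) K)) [hP : P.IsPrime] (hht : P.height ≤ 2)
    (hqP : ∀ i, q i ∈ P) (hX : X none ∈ P) : HasLinearSyzygy q ∨ InTwoLinearForms q := by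
  choose m g hm hg hmg using fun i => (hq i).exists_eq_X_none_mul_add
  obtain ⟨f, hf, hfP⟩ := comap_rename_some_eq_span_singleton P hht (a := 1) (b := 0)
    (by simpa using hX) (by simpa using (Ideal.ne_top_iff_one P).1 hP.ne_top)
  have hgP : ∀ i, rename some (g i) ∈ P := by
    intro i
    have : rename some (g i) = q i - X none * m i := by rw [hmg i]; ring
    rw [this]
    exact P.sub_mem (hqP i) (P.mul_mem_right _ hX)
  choose h hh using fun i => (hfP _).1 (hgP i)
  by_cases hg0 : ∀ i, g i = 0
  · left
    refine hasLinearSyzygy_of_pencil (z := X none) (b := m) 0 hm fun c _ => ?_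
    rw [Finset.mul_sum]
    refine Finset.sum_congr rfl fun i _ => ?_
    rw [hmg i, hg0 i, map_zero]
    ring
  push Not at hg0
  obtain ⟨j, hj⟩ := hg0
  have hf0 : f ≠ 0 := by
    rintro rfl
    exact hj (by rw [hh j, zero_mul])
  have hfp := hf.resolve_left hf0
  have hgj := hg j
  rw [hh j] at hgj hj
  obtain ⟨hfh, -, hdeg⟩ := hgj.of_mul hj
  have hd := hfp.totalDegree_ne_zero
  have hfd : f.totalDegree = 1 ∨ f.totalDegree = 2 := by omega
  rcases hfd with hfd | hfd
  · right
    rw [hfd] at hfh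
    refine ⟨X none, rename some f, m, fun i => rename some (h i), isHomogeneous_X _ _,
      hfh.rename_isHomogeneous, hm, fun i => ?_, fun i => ?_⟩
    · have := hg i
      rw [hh i] at this
      exact (IsHomogeneous.of_mul_left (m := 1) (n := 1) this hfh hf0).rename_isHomogeneous
    · rw [← map_mul, ← hh i, ← hmg i]
  · left
    rw [hfd] at hfh
    have hc : ∀ i, ∃ c, h i = C c := by
      intro i
      have := hg i
      rw [hh i] at this
      exact (IsHomogeneous.of_mul_left (m := 2) (n := 0) this hfh hf0).exists_eq_C
    choose r hr using hc
    refine hasLinearSyzygy_of_pencil (z := X none) (b := m) r hm fun c hc => ?_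
    have h1 : ∑ i, C (c i) * q i = X none * ∑ i, C (c i) * m i
        + rename some f * C (∑ i, c i * r i) := by
      rw [Finset.mul_sum, map_sum, Finset.mul_sum, ← Finset.sum_add_distrib]
      refine Finset.sum_congr rfl fun i _ => ?_
      rw [hmg i, hh i, hr i, map_mul, rename_C, map_mul]
      ring
    rw [h1, hc, map_zero, mul_zero, add_zero]

theorem MvPolynomial.IsHomogeneous.constantCoeff_eq_zero {σ : Type*} {p : MvPolynomial σ K} {n : ℕ}
    (hp : p.IsHomogeneous n) (hn : n ≠ 0) : constantCoeff p = 0 := by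
  rw [constantCoeff_eq]
  exact hp.coeff_eq_zero (by simpa using hn.symm)

theorem hasLinearSyzygy_of_minors_eq_zero {A : Type*} {q : Fin 3 → MvPolynomial A K}
    {l : Fin 3 → MvPolynomial A K} (hl : ∀ i, (l i).IsHomogeneous 1) (hl0 : l ≠ 0)
    (h : ∀ i j, l i * q j = l j * q i) : HasLinearSyzygy q := by
  obtain ⟨i, hi⟩ := Function.ne_iff.1 hl0
  obtain ⟨j, hij⟩ : ∃ j, i ≠ j := ⟨i + 1, by simp⟩
  refine ⟨Pi.single j (l i) - Pi.single i (l j), fun t => ?_, ?_, ?_⟩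
  · refine MvPolynomial.IsHomogeneous.sub ?_ ?_
    · rw [Pi.single_apply]; split_ifs
      · exact hl i
      · exact isHomogeneous_zero _ _ _
    · rw [Pi.single_apply]; split_ifs
      · exact hl j
      · exact isHomogeneous_zero _ _ _
  · intro h0
    have := congrFun h0 j
    simp [Pi.single_eq_of_ne hij.symm] at this
    exact hi this
  · simp [sub_mul, Finset.sum_sub_distrib, Pi.single_apply, h i j]

/-- Projection from the coordinate point `p`: each quadric is linear in `X none`, and eliminating
this variable leaves a principal prime containing the minors of `(l, g)`. -/
theorem hasLinearSyzygy_of_projection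
    {q : Fin 3 → MvPolynomial (Option τ) K} (hq : ∀ i, (q i).IsHomogeneous 2)
    [Finite τ] (P : Ideal (MvPolynomial (Option τ) K)) [hP : P.IsPrime] (hht : P.height ≤ 2)
    (hqP : ∀ i, q i ∈ P) (hlin : ∀ x ∈ P, x.IsHomogeneous 1 → x = 0)
    {p : Option τ → K} (hp : p none = 1) (hp' : ∀ t, p (some t) = 0)
    (hpq : ∀ i, eval p (q i) = 0) (hsm : ∃ i v, eval (p + v) (q i) ≠ eval v (q i)) :
    HasLinearSyzygy q := by
  have hps : p ∘ some = 0 := funext hp'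
  choose m g hm hg hmg using fun i => (hq i).exists_eq_X_none_mul_add
  choose m' l hm' hl hml using fun i => (hm i).exists_eq_X_none_mul_add
  choose c hc using fun i => (hm' i).exists_eq_C
  -- The coefficient of the square of `X none` is the value at `p`.
  have hc0 : ∀ i, c i = 0 := by
    intro i
    have := hpq i
    simpa [hmg i, hml i, hc i, hp, eval_rename, hps, (hg i).constantCoeff_eq_zero, (hl i).constantCoeff_eq_zero] using this
  have hlg : ∀ i, q i = X none * rename some (l i) + rename some (g i) := by
    intro i
    rw [hmg i, hml i, hc i, hc0 i, map_zero, mul_zero, zero_add]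
  -- Translation by `p` changes only the coordinate `none`, so a quadric that it alters must involve
  -- `X none`.
  have hl0 : ∃ i, l i ≠ 0 := by
    obtain ⟨i, v, hv⟩ := hsm
    refine ⟨i, fun h0 => hv ?_⟩
    have : (p + v) ∘ some = v ∘ some := by funext t; simp [hp']
    rw [hlg i, h0]
    simp [eval_rename, this]
  obtain ⟨i₀, hi₀⟩ := hl0
  have hinj : Function.Injective (rename (R := K) (some : τ → Option τ)) :=
    rename_injective _ (Option.some_injective _)
  obtain ⟨f, hf, hfP⟩ := comap_rename_some_eq_span_singleton P hht (a := l i₀) (b := g i₀)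
    (by rw [← hlg]; exact hqP _) (fun h => hi₀ (by
      have := hlin _ h (hl i₀).rename_isHomogeneous
      exact hinj (by rw [this, map_zero])))
  have hminor : ∀ i j, f ∣ l i * g j - l j * g i := by
    intro i j
    rw [← hfP]
    have : rename some (l i * g j - l j * g i) =
        rename some (l i) * q j - rename some (l j) * q i := by
      rw [hlg i, hlg j]; simp only [map_sub, map_mul]; ring
    rw [this]
    exact P.sub_mem (P.mul_mem_left _ (hqP j)) (P.mul_mem_left _ (hqP i))
  by_cases hn : ∀ i j, l i * g j - l j * g i = 0
  · refine hasLinearSyzygy_of_minors_eq_zero (l := fun i => rename some (l i))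
      (fun i => (hl i).rename_isHomogeneous) (fun h => hi₀ (hinj ?_)) fun i j => ?_
    · simpa using congrFun h i₀
    · have := congrArg (rename some) (hn i j)
      simp only [map_sub, map_mul, map_zero] at this
      rw [hlg i, hlg j]
      linear_combination this
  -- The cross product `l × g`, with indices modulo three: it is orthogonal to `l` and to `g`, and
  -- so is its quotient `h` by `f`.
  let n : Fin 3 → MvPolynomial τ K := fun i => l (i + 1) * g (i + 2) - l (i + 2) * g (i + 1)
  have hnh : ∀ i, (n i).IsHomogeneous 3 := fun i =>
    ((hl _).mul (hg _)).sub ((hl _).mul (hg _))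
  choose h hh using fun i : Fin 3 => hminor (i + 1) (i + 2)
  have hn0 : ∃ i, n i ≠ 0 := by
    by_contra! hall
    apply hn
    have h0 := hall 0
    have h1 := hall 1
    have h2 := hall 2
    simp only [n, Fin.isValue, show (1 : Fin 3) + 1 = 2 from rfl, show (1 : Fin 3) + 2 = 0 from rfl,
      show (2 : Fin 3) + 1 = 0 from rfl, show (2 : Fin 3) + 2 = 1 from rfl, zero_add] at h0 h1 h2
    intro i j
    fin_cases i <;> fin_cases j <;> simp only [Fin.zero_eta, Fin.mk_one, Fin.reduceFinMk, sub_self]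
    · exact h2
    · linear_combination -h1
    · linear_combination -h2
    · exact h0
    · exact h1
    · linear_combination -h0
  obtain ⟨j, hj⟩ := hn0
  have hnf : ∀ i, n i = f * h i := hh
  have hf0 : f ≠ 0 := by
    rintro rfl
    exact hj (by rw [hnf j, zero_mul])
  have hfp := hf.resolve_left hf0
  have hnj := hnh j
  rw [hnf j] at hnj hj
  obtain ⟨hfh, -, hdeg⟩ := hnj.of_mul hj
  have hhj : h j ≠ 0 := right_ne_zero_of_mul hj
  have hhh : ∀ i, (h i).IsHomogeneous (3 - f.totalDegree) := by
    intro i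
    have := hnh i
    rw [hnf i, show 3 = f.totalDegree + (3 - f.totalDegree) by omega] at this
    exact IsHomogeneous.of_mul_left this hfh hf0
  have hd0 := hfp.totalDegree_ne_zero
  have hd1 : f.totalDegree ≠ 1 := by
    intro hd1
    rw [hd1] at hfh
    have := hlin _ ((hfP f).2 dvd_rfl) hfh.rename_isHomogeneous
    exact hf0 (hinj (by rw [this, map_zero]))
  have hrel : ∀ w : Fin 3 → MvPolynomial τ K, ∑ i, n i * w i = 0 → ∑ i, h i * w i = 0 := by
    intro w hw
    have : f * ∑ i, h i * w i = 0 := by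
      rw [← hw, Finset.mul_sum]
      exact Finset.sum_congr rfl fun i _ => by rw [hnf i]; ring
    exact (mul_eq_zero.1 this).resolve_left hf0
  have hsl := hrel l (by
    simp only [n, Fin.sum_univ_three, show (1 : Fin 3) + 1 = 2 from rfl,
      show (1 : Fin 3) + 2 = 0 from rfl, show (2 : Fin 3) + 1 = 0 from rfl,
      show (2 : Fin 3) + 2 = 1 from rfl, zero_add]
    ring)
  have hsg := hrel g (by
    simp only [n, Fin.sum_univ_three, show (1 : Fin 3) + 1 = 2 from rfl,
      show (1 : Fin 3) + 2 = 0 from rfl, show (2 : Fin 3) + 1 = 0 from rfl,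
      show (2 : Fin 3) + 2 = 1 from rfl, zero_add]
    ring)
  have hsq : ∑ i, rename some (h i) * q i = 0 := by
    have : ∑ i, rename some (h i) * q i = X none * rename some (∑ i, h i * l i)
        + rename some (∑ i, h i * g i) := by
      rw [map_sum, map_sum, Finset.mul_sum, ← Finset.sum_add_distrib]
      refine Finset.sum_congr rfl fun i _ => ?_
      rw [hlg i, map_mul, map_mul]; ring
    rw [this, hsl, hsg]; simp
  have hd : f.totalDegree = 2 ∨ f.totalDegree = 3 := by omega
  rcases hd with hd | hd
  · refine ⟨fun i => rename some (h i), fun i => ?_, fun h0 => hhj (hinj ?_), hsq⟩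
    · have := hhh i
      rw [hd] at this
      exact this.rename_isHomogeneous
    · simpa using congrFun h0 j
  · have hc : ∀ i, ∃ c, h i = C c := by
      intro i
      have := hhh i
      rw [hd] at this
      exact this.exists_eq_C
    choose r hr using hc
    refine hasLinearSyzygy_of_linear_relation (c := r) (fun h0 => hhj ?_) ?_
    · rw [hr j, h0]; simp
    · simpa [hr] using hsq

end HeightTwoPrime

/-! ### Quadratic forms in arbitrary characteristic -/

section QuadraticForms

variable {K σ : Type*} [Field K]

theorem MvPolynomial.IsHomogeneous.exists_eq_sum_X_mul_X [Fintype σ] [DecidableEq σ]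
    {p : MvPolynomial σ K} (hp : p.IsHomogeneous 2) :
    ∃ c : Matrix σ σ K, p = ∑ s, ∑ t, C (c s t) * (X s * X t) := by
  rw [p.as_sum]
  refine Finset.sum_induction _
    (fun p => ∃ c : Matrix σ σ K, p = ∑ s, ∑ t, C (c s t) * (X s * X t)) ?_ ?_ ?_
  · rintro _ _ ⟨c, rfl⟩ ⟨d, rfl⟩
    exact ⟨c + d, by simp [add_mul, Finset.sum_add_distrib]⟩
  · exact ⟨0, by simp⟩
  · intro d hd
    have hd2 : d.degree = 2 := by
      by_contra h
      exact mem_support_iff.1 hd (hp.coeff_eq_zero h)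
    obtain ⟨s, hs⟩ : ∃ s, d s ≠ 0 := by
      by_contra! h
      have : d = 0 := Finsupp.ext h
      rw [this] at hd2
      simp at hd2
    obtain ⟨d', rfl⟩ : ∃ d', d = Finsupp.single s 1 + d' :=
      exists_add_of_le (Finsupp.single_le_iff.2 (Nat.one_le_iff_ne_zero.2 hs))
    obtain ⟨t, rfl⟩ : d' ∈ Set.range (fun t : σ => Finsupp.single t 1) := by
      rw [Finsupp.range_single_one]
      simp only [map_add, Finsupp.degree_single] at hd2
      show d'.degree = 1
      omega
    refine ⟨Matrix.single s t (coeff (Finsupp.single s 1 + Finsupp.single t 1) p), ?_⟩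
    rw [Finset.sum_eq_single s, Finset.sum_eq_single t]
    · rw [Matrix.single_apply_same, C_mul', X, X, monomial_mul, smul_monomial]
      simp
    · intro u _ hu
      simp [Matrix.single_apply_of_col_ne _ _ hu.symm]
    · simp
    · intro u _ hu
      simp [Matrix.single_apply_of_row_ne hu.symm]
    · simp

/-- No symmetry is asked of `β`: in characteristic two a symmetric choice need not exist. -/
theorem MvPolynomial.IsHomogeneous.exists_bilin [Finite σ] {p : MvPolynomial σ K}
    (hp : p.IsHomogeneous 2) : ∃ β : (σ → K) →ₗ[K] (σ → K) →ₗ[K] K, ∀ v, eval v p = β v v := by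
  classical
  have := Fintype.ofFinite σ
  obtain ⟨c, rfl⟩ := hp.exists_eq_sum_X_mul_X
  refine ⟨Matrix.toLinearMap₂' K c, fun v => ?_⟩
  simp [Matrix.toLinearMap₂'_apply, mul_comm, mul_left_comm]

end QuadraticForms

/-! ### The dichotomy over an algebraically closed field -/

section AlgClosed

variable {K σ : Type*} [Field K] [IsAlgClosed K]

/-- Comparing `p (2v) = 4 p v` with additivity gives `2 p = 0`. In characteristic two an additive
form is diagonal, and square roots of its coefficients exhibit it as a square. -/
theorem eq_sq_linForm_of_additive [Fintype σ] [DecidableEq σ] {p : MvPolynomial σ K}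
    (hp : p.IsHomogeneous 2) (hadd : ∀ u v, eval (u + v) p = eval u p + eval v p) :
    p = 0 ∨ ∃ φ : Module.Dual K (σ → K), p = linForm φ ^ 2 := by
  have hK : Infinite K := inferInstance
  obtain ⟨β, hβ⟩ := hp.exists_bilin
  by_cases h2 : (2 : K) = 0
  · right
    have hchar : CharP K 2 := CharTwo.of_one_ne_zero_of_two_eq_zero one_ne_zero h2
    choose r hr using fun s => IsAlgClosed.exists_pow_nat_eq (eval (Pi.single s 1) p) two_pos
    refine ⟨∑ s, r s • LinearMap.proj s, MvPolynomial.funext fun v => ?_⟩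
    have hsum : ∀ (w : σ → σ → K) (t : Finset σ),
        eval (∑ s ∈ t, w s) p = ∑ s ∈ t, eval (w s) p := by
      intro w t
      induction t using Finset.induction_on with
      | empty => rw [Finset.sum_empty, Finset.sum_empty, hβ, map_zero]
      | insert a t ha ih => rw [Finset.sum_insert ha, Finset.sum_insert ha, hadd, ih]
    have hv : v = ∑ s, v s • Pi.single s (1 : K) := pi_eq_sum_univ' v
    rw [map_pow, eval_linForm]
    conv_lhs => rw [hv, hsum]
    simp only [LinearMap.sum_apply, LinearMap.smul_apply, LinearMap.proj_apply, smul_eq_mul]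
    rw [CharTwo.sum_sq]
    refine Finset.sum_congr rfl fun s _ => ?_
    rw [mul_pow, hr, hβ, hβ]
    simp only [map_smul, LinearMap.smul_apply, smul_eq_mul]
    ring
  · left
    refine MvPolynomial.funext fun v => ?_
    have h := hadd v v
    rw [hβ, hβ] at h
    simp only [map_add, LinearMap.add_apply] at h
    rw [hβ, map_zero]
    have : (2 : K) * β v v = 0 := by linear_combination h
    exact (mul_eq_zero.1 this).resolve_left h2

/-- If every zero of `P` were a vertex, each polar form `β v + β.flip v` of `q 0` would vanish on
the zero locus, hence lie in `P` by the Nullstellensatz and be zero. Then `q 0` is additive, so it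
is zero or the square of a linear form in `P`; both are excluded. -/
theorem exists_zero_not_vertex [Finite σ] {q : Fin 3 → MvPolynomial σ K} (hq : ∀ i, (q i).IsHomogeneous 2)
    (P : Ideal (MvPolynomial σ K)) [hP : P.IsPrime] (hqP : ∀ i, q i ∈ P)
    (hlin : ∀ x ∈ P, x.IsHomogeneous 1 → x = 0) (hq0 : ∀ i, q i ≠ 0) :
    ∃ p : σ → K, (∀ g ∈ P, eval p g = 0) ∧ ∃ i v, eval (p + v) (q i) ≠ eval v (q i) := by
  classical
  have := Fintype.ofFinite σ
  by_contra! hcon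
  obtain ⟨β, hβ⟩ := (hq 0).exists_bilin
  have hadd : ∀ u v, eval (u + v) (q 0) = eval u (q 0) + eval v (q 0) := by
    intro u v
    let φ : Module.Dual K (σ → K) := β v + β.flip v
    have hφ : linForm φ ∈ P := by
      rw [← IsPrime.vanishingIdeal_zeroLocus (K := K) P, mem_vanishingIdeal_iff]
      intro p hp
      rw [mem_zeroLocus_iff] at hp
      have hp' : ∀ g ∈ P, eval p g = 0 := fun g hg => by simpa [aeval_eq_eval] using hp g hg
      have h1 := hcon p hp' 0 v
      have h2 := hp' _ (hqP 0)
      rw [hβ] at h2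
      rw [hβ, hβ] at h1
      simp only [map_add, LinearMap.add_apply] at h1
      rw [aeval_eq_eval]
      change eval p (linForm φ) = 0
      rw [eval_linForm]
      simp only [φ, LinearMap.add_apply, LinearMap.flip_apply]
      linear_combination h1 - h2
    have h0 := linForm_eq_zero.1 (hlin _ hφ (linForm_isHomogeneous _))
    have h1 : β v u + β u v = 0 := by
      simpa [φ] using LinearMap.congr_fun h0 u
    rw [hβ, hβ, hβ]
    simp only [map_add, LinearMap.add_apply]
    linear_combination h1
  rcases eq_sq_linForm_of_additive (hq 0) hadd with h | ⟨φ, h⟩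
  · exact hq0 0 h
  · have h1 : linForm φ ∈ P := hP.mem_of_pow_mem 2 (h ▸ hqP 0)
    exact hq0 0 (by rw [h, hlin _ h1 (linForm_isHomogeneous _)]; simp)

omit [IsAlgClosed K] in
theorem exists_transport {τ : Type*} [Fintype σ] [DecidableEq σ] [Fintype τ] [DecidableEq τ]
    (e : (σ → K) ≃ₗ[K] (τ → K)) {q : Fin 3 → MvPolynomial σ K} (hq : ∀ i, (q i).IsHomogeneous 2)
    (P : Ideal (MvPolynomial σ K)) [hP : P.IsPrime] (hht : P.height ≤ 2) (hqP : ∀ i, q i ∈ P) :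
    ∃ (q' : Fin 3 → MvPolynomial τ K) (P' : Ideal (MvPolynomial τ K)),
      (∀ i, (q' i).IsHomogeneous 2) ∧ P'.IsPrime ∧ P'.height ≤ 2 ∧ (∀ i, q' i ∈ P') ∧
      (∀ x, x ∈ P' ↔ coordHom e.toLinearMap x ∈ P) ∧
      (∀ i, coordHom e.toLinearMap (q' i) = q i) ∧
      (HasLinearSyzygy q' → HasLinearSyzygy q) ∧ (InTwoLinearForms q' → InTwoLinearForms q) := by
  have h1 : ∀ i, coordHom e.toLinearMap ((coordEquiv e).symm (q i)) = q i := fun i => by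
    rw [← coordEquiv_apply, AlgEquiv.apply_symm_apply]
  have hmem : ∀ x, x ∈ P.comap (coordEquiv e).toRingEquiv ↔ coordHom e.toLinearMap x ∈ P :=
    fun x => Iff.rfl
  refine ⟨fun i => (coordEquiv e).symm (q i), P.comap (coordEquiv e).toRingEquiv, fun i => ?_,
    Ideal.comap_isPrime _ _, ?_, fun i => ?_, hmem, h1, fun h => ?_, fun h => ?_⟩
  · exact (hq i).map_algHom (coordHom_X_isHomogeneous _)
  · rw [RingEquiv.height_comap]; exact hht
  · rw [hmem, h1]; exact hqP i
  · have := h.map (coordHom e.toLinearMap) (coordEquiv e).injective (coordHom_X_isHomogeneous _)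
    simpa only [h1] using this
  · have := h.map (coordHom e.toLinearMap) (coordHom_X_isHomogeneous _)
    simpa only [h1] using this

/-- Three quadrics in a prime of height at most two, over an algebraically closed field. -/
theorem hasLinearSyzygy_or_inTwoLinearForms [Finite σ] {q : Fin 3 → MvPolynomial σ K}
    (hq : ∀ i, (q i).IsHomogeneous 2) (P : Ideal (MvPolynomial σ K)) [hP : P.IsPrime]
    (hht : P.height ≤ 2) (hqP : ∀ i, q i ∈ P) (hq0 : ∀ i, q i ≠ 0) :
    HasLinearSyzygy q ∨ InTwoLinearForms q := by
  classical
  have := Fintype.ofFinite σ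
  by_cases hlin : ∀ x ∈ P, x.IsHomogeneous 1 → x = 0
  · left
    obtain ⟨p, hp, i, v, hv⟩ := exists_zero_not_vertex hq P hqP hlin hq0
    have hp0 : p ≠ 0 := by rintro rfl; simp at hv
    obtain ⟨d, e, he, he'⟩ := exists_coordinates_of_ne_zero hp0
    obtain ⟨q', P', hq', hP', hht', hqP', hmem, hqq', hs, -⟩ := exists_transport e hq P hht hqP
    refine hs (hasLinearSyzygy_of_projection hq' P' hht' hqP' (fun x hx hx1 => ?_)
      (p := e p) he he' (fun i => ?_) ⟨i, e v, ?_⟩)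
    · rw [hmem] at hx
      have := hlin _ hx (hx1.map_algHom (coordHom_X_isHomogeneous _))
      exact (coordEquiv e).injective (by rw [coordEquiv_apply, this, map_zero])
    · rw [← LinearEquiv.coe_coe, ← eval_coordHom, hqq']
      exact hp _ (hqP i)
    · rw [← map_add, ← LinearEquiv.coe_coe, ← eval_coordHom, ← eval_coordHom, hqq']
      exact hv
  · push Not at hlin
    obtain ⟨x, hxP, hx1, hx0⟩ := hlin
    obtain ⟨ξ, rfl⟩ := hx1.exists_eq_linForm
    obtain ⟨d, e, he⟩ := exists_coordinates_of_dual_ne_zero (mt linForm_eq_zero.2 hx0)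
    obtain ⟨q', P', hq', hP', hht', hqP', hmem, hqq', hs, ht⟩ := exists_transport e hq P hht hqP
    refine (hasLinearSyzygy_or_inTwoLinearForms_of_X_none_mem hq' P' hht' hqP' ?_).imp hs ht
    rw [hmem, coordHom_X]
    convert hxP
    exact LinearMap.ext fun v => he v

end AlgClosed

/-! ### Minimal generation and linear independence -/

section MinimalGenerators

variable {K σ : Type*} [Field K]

theorem MvPolynomial.coeff_mul_of_lowest_degree {h : MvPolynomial σ K} {n : ℕ}
    (hh : ∀ e : σ →₀ ℕ, e.degree < n → coeff e h = 0) (a : MvPolynomial σ K) {d : σ →₀ ℕ}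
    (hd : d.degree ≤ n) : coeff d (a * h) = constantCoeff a * coeff d h := by
  classical
  rw [coeff_mul, Finset.sum_eq_single (0, d)]
  · rfl
  · rintro ⟨u, v⟩ huv hne
    rw [Finset.HasAntidiagonal.mem_antidiagonal] at huv
    simp only at huv
    have hdeg : u.degree + v.degree = d.degree := by rw [← huv, map_add]
    by_cases hv : v.degree < n
    · rw [hh v hv, mul_zero]
    · exfalso
      apply hne
      have hu : u.degree = 0 := by omega
      rw [Finsupp.degree_eq_zero_iff] at hu
      subst hu
      rw [zero_add] at huv
      rw [huv]
  · intro h0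
    simp at h0

theorem MinimallyGenerates.linearIndependent {q : Fin 3 → MvPolynomial σ K}
    {I : Ideal (MvPolynomial σ K)} (h : MinimallyGenerates q I) : LinearIndependent K q := by
  rw [Fintype.linearIndependent_iff]
  intro c hc
  by_contra! hcon
  obtain ⟨j, hj⟩ := hcon
  apply h.2 j
  rw [← h.1]
  apply le_antisymm (Ideal.span_mono (Set.image_subset_range _ _))
  rw [Ideal.span_le]
  rintro _ ⟨i, rfl⟩
  by_cases hij : i = j
  · subst hij
    have : q i = ∑ t ∈ Finset.univ.erase i, C (- (c i)⁻¹ * c t) * q t := by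
      have h1 : c i • q i + ∑ t ∈ Finset.univ.erase i, c t • q t = 0 := by
        rw [Finset.add_sum_erase _ (fun t => c t • q t) (Finset.mem_univ i), hc]
      have h2 : q i = (c i)⁻¹ • (c i • q i) := by rw [smul_smul, inv_mul_cancel₀ hj, one_smul]
      rw [h2, eq_neg_of_add_eq_zero_left h1, smul_neg, Finset.smul_sum, ← Finset.sum_neg_distrib]
      refine Finset.sum_congr rfl fun t _ => ?_
      rw [smul_smul, ← C_mul', neg_mul, map_neg, neg_mul]
    rw [this]
    refine Ideal.sum_mem _ fun t ht => Ideal.mul_mem_left _ _ (Ideal.subset_span ⟨t, ?_, rfl⟩)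
    exact Finset.ne_of_mem_erase ht
  · exact Ideal.subset_span ⟨i, hij, rfl⟩

/-- In degree `n` the ideal generated by forms of degree `n` is just their linear span, because only
the constant terms of the multipliers contribute. -/
theorem minimallyGenerates_of_linearIndependent {q : Fin 3 → MvPolynomial σ K} {n : ℕ}
    (hq : ∀ i, (q i).IsHomogeneous n) (hli : LinearIndependent K q) :
    MinimallyGenerates q (Ideal.span (Set.range q)) := by
  refine ⟨rfl, fun j h => ?_⟩
  have hj : q j ∈ Ideal.span (q '' {i | i ≠ j}) := by
    rw [h]; exact Ideal.subset_span ⟨j, rfl⟩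
  have key : ∀ p ∈ Ideal.span (q '' {i | i ≠ j}), ∃ c : Fin 3 → K, c j = 0 ∧
      (∀ d : σ →₀ ℕ, d.degree < n → coeff d p = 0) ∧
      ∀ d : σ →₀ ℕ, d.degree = n → coeff d p = ∑ i, c i * coeff d (q i) := by
    intro p hp
    refine Submodule.span_induction ?_ ?_ ?_ ?_ hp
    · rintro _ ⟨i, hi, rfl⟩
      exact ⟨Pi.single i 1, Pi.single_eq_of_ne (Ne.symm hi) _,
        fun d hd => (hq i).coeff_eq_zero hd.ne, fun d _ => by simp [Pi.single_apply]⟩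
    · exact ⟨0, rfl, fun d _ => by simp, fun d _ => by simp⟩
    · rintro x y _ _ ⟨c, hc, hx', hx⟩ ⟨e, he, hy', hy⟩
      exact ⟨c + e, by simp [hc, he], fun d hd => by simp [hx' d hd, hy' d hd], fun d hd => by
        simp [hx d hd, hy d hd, add_mul, Finset.sum_add_distrib]⟩
    · rintro a x - ⟨c, hc, hx', hx⟩
      refine ⟨constantCoeff a • c, by simp [hc], fun d hd => ?_, fun d hd => ?_⟩
      · rw [smul_eq_mul, coeff_mul_of_lowest_degree hx' a hd.le, hx' d hd, mul_zero]
      · rw [smul_eq_mul, coeff_mul_of_lowest_degree hx' a hd.le, hx d hd, Finset.mul_sum]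
        simp [mul_assoc]
  obtain ⟨c, hc, -, hd⟩ := key _ hj
  have h1 : ∑ i, (c i - (Pi.single j 1 : Fin 3 → K) i) • q i = 0 := by
    ext d
    by_cases hdn : d.degree = n
    · simp [coeff_sum, sub_smul, Finset.sum_sub_distrib, ← hd d hdn, Pi.single_apply]
    · simp [coeff_sum, (hq _).coeff_eq_zero hdn]
  have := Fintype.linearIndependent_iff.1 hli _ h1 j
  simp [hc] at this

end MinimalGenerators

/-! ### Consequences of a linear syzygy -/

section LinearForms

variable {K σ : Type*} [Field K] [Finite σ]

theorem MvPolynomial.IsHomogeneous.prime_of_ne_zero {x : MvPolynomial σ K}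
    (hx : x.IsHomogeneous 1) (h0 : x ≠ 0) : Prime x := by
  classical
  have := Fintype.ofFinite σ
  obtain ⟨ξ, rfl⟩ := hx.exists_eq_linForm
  obtain ⟨d, e, he⟩ := exists_coordinates_of_dual_ne_zero (mt linForm_eq_zero.2 h0)
  have h1 : linForm ξ = coordEquiv e (X none) := by
    rw [coordEquiv_apply, coordHom_X]
    congr 1
    exact LinearMap.ext fun v => (he v).symm
  rw [h1]
  exact (MulEquiv.prime_iff (coordEquiv e)).2 X_prime

/-- Solving for `m 2` and absorbing it into the generators leaves `m 0 * q' 0 + m 1 * q' 1 = 0`. If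
the prime `m 0` divided `m 1`, the `q'` would be dependent; so `q' 1 = m 0 * y`, `q' 0 = - m 1 * y`,
and `y` is the common factor. -/
theorem exists_shareLinearFactor_of_dependent {q m : Fin 3 → MvPolynomial σ K}
    (hq : ∀ i, (q i).IsHomogeneous 2) (hli : LinearIndependent K q)
    (hm : ∀ i, (m i).IsHomogeneous 1) (hm0 : m ≠ 0) (hmq : ∑ i, m i * q i = 0) {c : Fin 3 → K}
    (hc : c 2 ≠ 0) (hcm : ∑ i, c i • m i = 0) :
    ∃ q' : Fin 3 → MvPolynomial σ K, (∀ i, (q' i).IsHomogeneous 2) ∧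
      LinearIndependent K q' ∧ Ideal.span (Set.range q') = Ideal.span (Set.range q) ∧
      ShareLinearFactor (q' 0) (q' 1) := by
  obtain ⟨α, β, hαβ⟩ : ∃ α β : K, m 2 = - (C α * m 0) - C β * m 1 := by
    refine ⟨c 0 / c 2, c 1 / c 2, ?_⟩
    have h2 : m 2 = (c 2)⁻¹ • (c 2 • m 2) := by rw [smul_smul, inv_mul_cancel₀ hc, one_smul]
    have h3 : c 2 • m 2 = - (c 0 • m 0) - c 1 • m 1 := by
      rw [Fin.sum_univ_three] at hcm
      linear_combination hcm
    rw [h2, h3]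
    simp only [C_mul', smul_sub, smul_neg, smul_smul, div_eq_inv_mul]
  let q' : Fin 3 → MvPolynomial σ K := ![q 0 - C α * q 2, q 1 - C β * q 2, q 2]
  have hrel : m 0 * q' 0 + m 1 * q' 1 = 0 := by
    rw [Fin.sum_univ_three, hαβ] at hmq
    simp only [q', Matrix.cons_val_zero, Matrix.cons_val_one]
    linear_combination hmq
  have hli' : LinearIndependent K q' := by
    rw [Fintype.linearIndependent_iff] at hli ⊢
    intro g hg
    have h1 := hli ![g 0, g 1, g 2 - α * g 0 - β * g 1] (by
      simp only [Fin.sum_univ_three, q', ← C_mul', Matrix.cons_val_zero, Matrix.cons_val_one,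
        Matrix.cons_val, map_sub, map_mul] at hg ⊢
      linear_combination hg)
    have h10 : g 0 = 0 := h1 0
    have h11 : g 1 = 0 := h1 1
    have h12 : g 2 - α * g 0 - β * g 1 = 0 := h1 2
    rw [h10, h11] at h12
    intro i
    fin_cases i
    · exact h10
    · exact h11
    · simpa using h12
  have hq' : ∀ i, (q' i).IsHomogeneous 2 := by
    intro i
    fin_cases i
    · exact (hq 0).sub ((hq 2).C_mul α)
    · exact (hq 1).sub ((hq 2).C_mul β)
    · exact hq 2
  have hspan : Ideal.span (Set.range q') = Ideal.span (Set.range q) := by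
    have hmem : ∀ i, q i ∈ Ideal.span (Set.range q) := fun i => Ideal.subset_span ⟨i, rfl⟩
    have hmem' : ∀ i, q' i ∈ Ideal.span (Set.range q') := fun i => Ideal.subset_span ⟨i, rfl⟩
    apply le_antisymm <;> rw [Ideal.span_le]
    · rintro _ ⟨i, rfl⟩
      fin_cases i
      · exact Ideal.sub_mem _ (hmem 0) (Ideal.mul_mem_left _ _ (hmem 2))
      · exact Ideal.sub_mem _ (hmem 1) (Ideal.mul_mem_left _ _ (hmem 2))
      · exact hmem 2
    · have h2 : q 2 ∈ Ideal.span (Set.range q') := hmem' 2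
      rintro _ ⟨i, rfl⟩
      fin_cases i
      · have h : q 0 = q' 0 + C α * q 2 := by simp [q']
        show q 0 ∈ _
        rw [h]
        exact Ideal.add_mem _ (hmem' 0) (Ideal.mul_mem_left _ _ h2)
      · have h : q 1 = q' 1 + C β * q 2 := by simp [q']
        show q 1 ∈ _
        rw [h]
        exact Ideal.add_mem _ (hmem' 1) (Ideal.mul_mem_left _ _ h2)
      · exact h2
  refine ⟨q', hq', hli', hspan, ?_⟩
  have hm00 : m 0 ≠ 0 := by
    intro h0
    have h1 : m 1 ≠ 0 := by
      intro h1
      apply hm0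
      funext i
      fin_cases i
      · exact h0
      · exact h1
      · show m 2 = 0
        rw [hαβ, h0, h1]; simp
    rw [h0, zero_mul, zero_add] at hrel
    exact hli'.ne_zero 1 ((mul_eq_zero.1 hrel).resolve_left h1)
  have hp := (hm 0).prime_of_ne_zero hm00
  have hdvd : m 0 ∣ m 1 * q' 1 := ⟨- q' 0, by linear_combination hrel⟩
  rcases hp.dvd_or_dvd hdvd with ⟨y, hy⟩ | ⟨y, hy⟩
  · exfalso
    have h1 := hm 1
    rw [hy] at h1
    obtain ⟨γ, rfl⟩ : ∃ γ, y = C γ :=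
      (IsHomogeneous.of_mul_left (m := 1) (n := 0) h1 (hm 0) hm00).exists_eq_C
    have h2 : m 0 * (q' 0 + C γ * q' 1) = 0 := by
      rw [hy] at hrel
      linear_combination hrel
    have h3 := (mul_eq_zero.1 h2).resolve_left hm00
    have := Fintype.linearIndependent_iff.1 hli' ![1, γ, 0] (by
      simpa [Fin.sum_univ_three, C_mul'] using h3) 0
    simp at this
  · have h1 := hq' 1
    rw [hy] at h1
    have hyh : y.IsHomogeneous 1 := IsHomogeneous.of_mul_left (m := 1) (n := 1) h1 (hm 0) hm00
    refine ⟨y, hyh, ?_, ⟨- m 1, ?_⟩, ⟨m 0, by rw [hy]; ring⟩⟩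
    · rintro rfl
      exact hli'.ne_zero 1 (by rw [hy, mul_zero])
    · have h2 : m 0 * (q' 0 + m 1 * y) = 0 := by
        rw [hy] at hrel
        linear_combination hrel
      linear_combination (mul_eq_zero.1 h2).resolve_left hm00

omit [Finite σ] in
theorem MvPolynomial.X_dvd_sub_aeval_update [DecidableEq σ] (s : σ) (p : MvPolynomial σ K) :
    X s ∣ p - aeval (Function.update X s 0 : σ → MvPolynomial σ K) p := by
  induction p using MvPolynomial.induction_on with
  | C a => simp
  | add p q hp hq =>
    simp only [map_add]
    convert dvd_add hp hq using 1
    ring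
  | mul_X p t hp =>
    simp only [map_mul, aeval_X]
    by_cases ht : t = s
    · subst ht; simp
    · rw [Function.update_of_ne ht, ← sub_mul]
      exact hp.mul_right _

omit [Finite σ] in
theorem MvPolynomial.IsHomogeneous.exists_eq_X_mul_add [DecidableEq σ] (s : σ)
    {p : MvPolynomial σ K} {n : ℕ} (hp : p.IsHomogeneous (n + 1)) :
    (MvPolynomial.aeval (Function.update X s 0 : σ → MvPolynomial σ K) p).IsHomogeneous (n + 1) ∧
    ∃ m : MvPolynomial σ K, m.IsHomogeneous n ∧
      p = X s * m + MvPolynomial.aeval (Function.update X s 0 : σ → MvPolynomial σ K) p := by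
  have hg : (MvPolynomial.aeval (Function.update X s 0 : σ → MvPolynomial σ K) p).IsHomogeneous
      (n + 1) := by
    apply hp.map_algHom
    intro t
    rw [aeval_X]
    by_cases ht : t = s
    · subst ht; rw [Function.update_self]; exact isHomogeneous_zero _ _ _
    · rw [Function.update_of_ne ht]; exact isHomogeneous_X _ _
  refine ⟨hg, ?_⟩
  obtain ⟨m, hm⟩ := X_dvd_sub_aeval_update s p
  refine ⟨m, ?_, by rw [← hm]; ring⟩
  have h : (X s * m).IsHomogeneous (1 + n) := by
    rw [← hm, add_comm]
    exact MvPolynomial.IsHomogeneous.sub hp hg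
  exact MvPolynomial.IsHomogeneous.of_mul_left h (isHomogeneous_X _ _) (X_ne_zero _)

omit [Finite σ] in
/-- Exactness of the Koszul complex of three variables, in degree two. -/
theorem exists_koszul [DecidableEq σ] {q : Fin 3 → MvPolynomial σ K}
    (hq : ∀ i, (q i).IsHomogeneous 2) {s : Fin 3 → σ} (hs : Function.Injective s)
    (h : ∑ i, X (s i) * q i = 0) :
    ∃ a b c : MvPolynomial σ K, a.IsHomogeneous 1 ∧ b.IsHomogeneous 1 ∧ c.IsHomogeneous 1 ∧
      q 0 = - (a * X (s 2)) - c * X (s 1) ∧ q 1 = - (b * X (s 2)) + c * X (s 0) ∧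
      q 2 = a * X (s 0) + b * X (s 1) := by
  have h01 : s 1 ≠ s 0 := fun h => by simpa using hs h
  have h02 : s 2 ≠ s 0 := fun h => by simpa using hs h
  have h12 : s 2 ≠ s 1 := fun h => by simpa using hs h
  obtain ⟨hg, a, ha, haq⟩ := (hq 2).exists_eq_X_mul_add (n := 1) (s 0)
  set g := aeval (Function.update X (s 0) 0 : σ → MvPolynomial σ K) (q 2) with hgdef
  obtain ⟨-, b, hb, hbq⟩ := hg.exists_eq_X_mul_add (n := 1) (s 1)
  rw [Fin.sum_univ_three] at h
  -- Setting the first two variables to zero in the relation leaves the third variable times the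
  -- residue of `q 2`.
  have h2 : aeval (Function.update X (s 1) 0 : σ → MvPolynomial σ K) g = 0 := by
    have := congrArg (fun p => aeval (Function.update X (s 1) 0 : σ → MvPolynomial σ K)
      (aeval (Function.update X (s 0) 0 : σ → MvPolynomial σ K) p)) h
    simpa [Function.update_of_ne h01, Function.update_of_ne h02, Function.update_of_ne h12,
      hgdef] using this
  rw [h2, add_zero] at hbq
  rw [hbq] at haq
  have h3 : X (s 0) * (q 0 + a * X (s 2)) + X (s 1) * (q 1 + b * X (s 2)) = 0 := by
    rw [haq] at h
    linear_combination h
  have hdvd : (X (s 0) : MvPolynomial σ K) ∣ X (s 1) * (q 1 + b * X (s 2)) :=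
    ⟨- (q 0 + a * X (s 2)), by linear_combination h3⟩
  obtain ⟨c, hc⟩ := (X_prime.dvd_or_dvd hdvd).resolve_left (by
    rw [X_dvd_X]; simp [h01.symm])
  have hcq : (q 1 + b * X (s 2)).IsHomogeneous (1 + 1) :=
    (hq 1).add (hb.mul (isHomogeneous_X _ _))
  rw [hc] at hcq
  refine ⟨a, b, c, ha, hb, IsHomogeneous.of_mul_left hcq (isHomogeneous_X _ _) (X_ne_zero _), ?_,
    by linear_combination hc, by linear_combination haq⟩
  have h4 : X (s 0) * (q 0 + a * X (s 2) + c * X (s 1)) = 0 := by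
    rw [hc] at h3
    linear_combination h3
  linear_combination (mul_eq_zero.1 h4).resolve_left (X_ne_zero _)

theorem expressible_of_linearIndependent_syzygy {q m : Fin 3 → MvPolynomial σ K}
    (hq : ∀ i, (q i).IsHomogeneous 2) (hm : ∀ i, (m i).IsHomogeneous 1)
    (hli : LinearIndependent K m) (hmq : ∑ i, m i * q i = 0) :
    ExpressibleInLinearForms q 8 := by
  classical
  have := Fintype.ofFinite σ
  choose ξ hξ using fun i => (hm i).exists_eq_linForm
  have hξli : LinearIndependent K ξ := by
    rw [Fintype.linearIndependent_iff] at hli ⊢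
    intro g hg
    apply hli
    have := linForm_sum_smul Finset.univ g ξ
    rw [hg, linForm_eq_zero.2 rfl] at this
    simp only [hξ, ← C_mul', ← this]
  obtain ⟨d, e, he⟩ := exists_coordinates_of_linearIndependent hξli
  have hX : ∀ i, coordEquiv e (X (Sum.inl i)) = m i := by
    intro i
    rw [coordEquiv_apply, coordHom_X, hξ i]
    congr 1
    exact LinearMap.ext fun v => he v i
  have hhom : ∀ {p : MvPolynomial (Fin 3 ⊕ Fin d) K} {n : ℕ}, p.IsHomogeneous n →
      (coordEquiv e p).IsHomogeneous n := fun hp => by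
    rw [coordEquiv_apply]; exact hp.map_algHom (coordHom_X_isHomogeneous _)
  obtain ⟨a, b, c, ha, hb, hc, h0, h1, h2⟩ := exists_koszul
    (q := fun i => (coordEquiv e).symm (q i)) (s := Sum.inl) (fun i => by
      rw [coordEquiv_symm_apply]; exact (hq i).map_algHom (coordHom_X_isHomogeneous _))
    Sum.inl_injective (by
      apply (coordEquiv e).injective
      simpa [hX] using hmq)
  have h0' := congrArg (coordEquiv e) h0
  have h1' := congrArg (coordEquiv e) h1
  have h2' := congrArg (coordEquiv e) h2
  simp only [map_add, map_sub, map_neg, map_mul, AlgEquiv.apply_symm_apply, hX] at h0' h1' h2'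
  -- Six forms suffice here; zeros fill the remaining places.
  let l : Fin 8 → MvPolynomial σ K :=
    ![m 0, m 1, m 2, coordEquiv e a, coordEquiv e b, coordEquiv e c, 0, 0]
  have hmem : ∀ j, l j ∈ Algebra.adjoin K (Set.range l) := fun j =>
    Algebra.subset_adjoin ⟨j, rfl⟩
  refine ⟨l, fun j => ?_, fun i => ?_⟩
  · fin_cases j
    · exact hm 0
    · exact hm 1
    · exact hm 2
    · exact hhom ha
    · exact hhom hb
    · exact hhom hc
    · exact isHomogeneous_zero _ _ _
    · exact isHomogeneous_zero _ _ _
  · fin_cases i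
    · show q 0 ∈ _
      rw [h0']
      exact sub_mem (neg_mem (mul_mem (hmem 3) (hmem 2))) (mul_mem (hmem 5) (hmem 1))
    · show q 1 ∈ _
      rw [h1']
      exact add_mem (neg_mem (mul_mem (hmem 4) (hmem 2))) (mul_mem (hmem 5) (hmem 0))
    · show q 2 ∈ _
      rw [h2']
      exact add_mem (mul_mem (hmem 3) (hmem 0)) (mul_mem (hmem 4) (hmem 1))

theorem HasLinearSyzygy.expressible_or_shareLinearFactor {q : Fin 3 → MvPolynomial σ K}
    (h : HasLinearSyzygy q) (hq : ∀ i, (q i).IsHomogeneous 2) (hli : LinearIndependent K q) :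
    ExpressibleInLinearForms q 8 ∨ ∃ q' : Fin 3 → MvPolynomial σ K,
      (∀ i, (q' i).IsHomogeneous 2) ∧ MinimallyGenerates q' (Ideal.span (Set.range q)) ∧
        ShareLinearFactor (q' 0) (q' 1) := by
  obtain ⟨m, hm, hm0, hmq⟩ := h
  by_cases hmli : LinearIndependent K m
  · exact Or.inl (expressible_of_linearIndependent_syzygy hq hm hmli hmq)
  · right
    rw [Fintype.linearIndependent_iff] at hmli
    push Not at hmli
    obtain ⟨c, hc, j, hj⟩ := hmli
    -- Moves an index with nonzero coefficient to the last place.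
    let π : Equiv.Perm (Fin 3) := Equiv.swap 2 j
    obtain ⟨q', hq', hli', hspan, hshare⟩ := exists_shareLinearFactor_of_dependent
      (q := q ∘ π) (m := m ∘ π) (fun i => hq _) (hli.comp π π.injective) (fun i => hm _)
      (fun h0 => hm0 (funext fun i => by simpa using congrFun h0 (π.symm i)))
      (by simpa using (Equiv.sum_comp π fun i => m i * q i).trans hmq) (c := c ∘ π)
      (by simpa [π] using hj) (by simpa using (Equiv.sum_comp π fun i => c i • m i).trans hc)
    refine ⟨q', hq', ?_, hshare⟩
    have := minimallyGenerates_of_linearIndependent hq' hli'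
    rwa [hspan, π.surjective.range_comp] at this

end LinearForms

/-! ### Extension of the base field -/

section BaseChange

variable {k K σ : Type*} [Field k] [Field K] [Algebra k K]

/-- A `k`-linear functional on `K` that is nonzero on one coefficient turns a relation over `K` into
a nontrivial relation over `k`. -/
theorem LinearIndependent.algebraMap_comp {ι ρ : Type*} [Fintype ι] {f : ι → ρ → k}
    (hf : LinearIndependent k f) :
    LinearIndependent K (fun i r => algebraMap k K (f i r)) := by
  rw [Fintype.linearIndependent_iff] at hf ⊢
  intro c hc
  by_contra! hcon
  obtain ⟨j, hj⟩ := hcon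
  obtain ⟨φ, hφ⟩ : ∃ φ : Module.Dual k K, φ (c j) ≠ 0 := by
    by_contra! h
    exact hj ((Module.forall_dual_apply_eq_zero_iff k (c j)).1 h)
  refine hφ (hf (fun i => φ (c i)) ?_ j)
  funext r
  have h1 := congrArg φ (congrFun hc r)
  simp only [Finset.sum_apply, Pi.smul_apply, smul_eq_mul, Pi.zero_apply, map_zero, map_sum] at h1 ⊢
  rw [← h1]
  refine Finset.sum_congr rfl fun i _ => ?_
  rw [mul_comm (c i), ← Algebra.smul_def, map_smul, smul_eq_mul, mul_comm]

theorem LinearIndependent.mvPolynomial_map {ι : Type*} [Fintype ι] {w : ι → MvPolynomial σ k}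
    (hw : LinearIndependent k w) :
    LinearIndependent K (fun i => MvPolynomial.map (algebraMap k K) (w i)) := by
  have h1 : LinearIndependent k (fun i d => coeff d (w i)) := by
    rw [Fintype.linearIndependent_iff] at hw ⊢
    intro g hg
    apply hw
    ext d
    simpa [coeff_sum] using congrFun hg d
  have h2 := h1.algebraMap_comp (K := K)
  rw [Fintype.linearIndependent_iff] at h2 ⊢
  intro g hg
  apply h2
  funext d
  have := congrArg (coeff d) hg
  simpa [coeff_sum, coeff_map] using this

/-- A linear syzygy is a linear relation among the products `X s * q i`, and independence of these
persists over `K`. -/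
theorem HasLinearSyzygy.of_map [Finite σ] {q : Fin 3 → MvPolynomial σ k}
    (h : HasLinearSyzygy fun i => MvPolynomial.map (algebraMap k K) (q i)) :
    HasLinearSyzygy q := by
  classical
  have := Fintype.ofFinite σ
  obtain ⟨m, hm, hm0, hmq⟩ := h
  by_contra hcon
  have hli : LinearIndependent k (fun p : Fin 3 × σ => X p.2 * q p.1) := by
    rw [Fintype.linearIndependent_iff]
    intro g hg
    by_contra! hg0
    obtain ⟨⟨j, t⟩, hj⟩ := hg0
    refine hcon ⟨fun i => linForm (∑ s, g (i, s) • LinearMap.proj s),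
      fun i => linForm_isHomogeneous _, fun h0 => ?_, ?_⟩
    · have h1 := linForm_eq_zero.1 (congrFun h0 j)
      have h2 := LinearMap.congr_fun h1 (Pi.single t 1)
      simp [Pi.single_apply] at h2
      exact hj h2
    · rw [← hg, Fintype.sum_prod_type]
      refine Finset.sum_congr rfl fun i _ => ?_
      dsimp only
      rw [linForm_sum_smul, Finset.sum_mul]
      refine Finset.sum_congr rfl fun s _ => ?_
      rw [linForm_proj, ← C_mul', mul_assoc]
  have hK := Fintype.linearIndependent_iff.1 (hli.mvPolynomial_map (K := K))
  choose ξ hξ using fun i => (hm i).exists_eq_linForm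
  have h0 := hK (fun p => ξ p.1 (Pi.single p.2 1)) (by
    rw [← hmq, Fintype.sum_prod_type]
    refine Finset.sum_congr rfl fun i _ => ?_
    rw [hξ i, linForm, Finset.sum_mul]
    refine Finset.sum_congr rfl fun s _ => ?_
    rw [map_mul, map_X, ← C_mul', mul_assoc])
  apply hm0
  funext i
  rw [hξ i, linForm]
  exact Finset.sum_eq_zero fun s _ => by rw [h0 (i, s), map_zero, zero_mul]

-- The extension of polynomial rings is integral. Lying over provides `Q` above a prime `P` of the
-- same height as `J`, and incomparability sends chains below `Q` to strict chains below `P`.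
attribute [local instance] MvPolynomial.algebraMvPolynomial in
theorem exists_prime_height_le_map_mem [Algebra.IsAlgebraic k K] {J : Ideal (MvPolynomial σ k)}
    {n : ℕ} (hJ : J.height ≤ n) : ∃ Q : Ideal (MvPolynomial σ K), Q.IsPrime ∧ Q.height ≤ n ∧
      ∀ g ∈ J, MvPolynomial.map (algebraMap k K) g ∈ Q := by
  obtain ⟨m, hm⟩ := ENat.ne_top_iff_exists.1 (ne_top_of_le_ne_top (ENat.natCast_ne_top n) hJ)
  obtain ⟨P, hP, hJP, hPm⟩ := Ideal.exists_isPrime_height_eq hm.symm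
  have hint : Algebra.IsIntegral (MvPolynomial σ k) (MvPolynomial σ K) :=
    ⟨fun x => isIntegral_iff_isIntegral_coeff.2 fun d => Algebra.IsIntegral.isIntegral _⟩
  have hinj : Function.Injective (algebraMap (MvPolynomial σ k) (MvPolynomial σ K)) :=
    map_injective _ (algebraMap k K).injective
  obtain ⟨Q, -, hQ, hQP⟩ := Ideal.exists_ideal_over_prime_of_isIntegral P
    (⊥ : Ideal (MvPolynomial σ K)) (by
      intro x hx
      rw [Ideal.mem_comap, Ideal.mem_bot] at hx
      rw [(map_eq_zero_iff _ hinj).1 hx]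
      exact zero_mem _)
  refine ⟨Q, hQ, ?_, fun g hg => ?_⟩
  · have hmono : StrictMono (PrimeSpectrum.comap (algebraMap (MvPolynomial σ k)
        (MvPolynomial σ K))) := by
      intro I I' hlt
      exact Ideal.IsIntegral.comap_lt_comap hlt
    have := Order.height_le_height_apply_of_strictMono _ hmono ⟨Q, hQ⟩
    rw [← PrimeSpectrum.height_eq_orderHeight, ← PrimeSpectrum.height_eq_orderHeight] at this
    refine this.trans ?_
    rw [PrimeSpectrum.comap_asIdeal, hQP, hPm, hm]
    exact hJ
  · have : g ∈ Q.comap (algebraMap (MvPolynomial σ k) (MvPolynomial σ K)) := by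
      rw [hQP]; exact hJP hg
    exact this

theorem Matrix.rank_le_rank_map {ρ : Type*} [Fintype σ] [Fintype ρ] (H : Matrix ρ σ k) :
    H.rank ≤ (H.map (algebraMap k K)).rank := by
  classical
  let b := Module.finBasis k (LinearMap.range H.mulVecLin)
  have hb : LinearIndependent k ((LinearMap.range H.mulVecLin).subtype ∘ b) :=
    b.linearIndependent.map' _ (Submodule.ker_subtype _)
  have hb' := hb.algebraMap_comp (K := K)
  have hmem : ∀ i, (fun r => algebraMap k K ((b i : ρ → k) r)) ∈
      LinearMap.range (H.map (algebraMap k K)).mulVecLin := by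
    intro i
    obtain ⟨v, hv⟩ := (b i).2
    refine ⟨fun s => algebraMap k K (v s), ?_⟩
    rw [← hv]
    funext r
    simp [Matrix.mulVec, dotProduct]
  have h2 : LinearIndependent K (fun i => (⟨_, hmem i⟩ :
      LinearMap.range (H.map (algebraMap k K)).mulVecLin)) :=
    LinearIndependent.of_comp (Submodule.subtype _) hb'
  simpa [Matrix.rank] using h2.fintype_card_le_finrank

end BaseChange

/-! ### Kernel vectors of the polar forms -/

section Vertex

variable {F σ : Type*} [Field F] [Fintype σ] [DecidableEq σ]

omit [DecidableEq σ] in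
theorem eval_sum_X_mul_X (c : Matrix σ σ F) (v : σ → F) :
    eval v (∑ s, ∑ t, C (c s t) * (X s * X t)) = v ⬝ᵥ (c.mulVec v) := by
  simp [dotProduct, Matrix.mulVec, Finset.mul_sum, mul_left_comm]

omit [DecidableEq σ] in
theorem eval_add_smul_sum_X_mul_X (c : Matrix σ σ F) (u v : σ → F) (r : F) :
    eval (u + r • v) (∑ s, ∑ t, C (c s t) * (X s * X t)) =
      eval u (∑ s, ∑ t, C (c s t) * (X s * X t)) +
      r ^ 2 * eval v (∑ s, ∑ t, C (c s t) * (X s * X t)) + r * (u ⬝ᵥ ((c + c.transpose).mulVec v)) := by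
  have h : v ⬝ᵥ (c.mulVec u) = u ⬝ᵥ (c.transpose.mulVec v) := by
    rw [Matrix.dotProduct_mulVec, Matrix.mulVec_transpose, dotProduct_comm]
  simp only [eval_sum_X_mul_X, Matrix.mulVec_add, Matrix.mulVec_smul, add_dotProduct,
    dotProduct_add, smul_dotProduct, dotProduct_smul, smul_eq_mul, Matrix.add_mulVec, h]
  ring

/-- Project along `w` onto the hyperplane `x = 0`. This changes `q i` by a multiple of `eval w (q
i)`, so combinations killing these values are unchanged; as `x` pulls back to zero, they are
divisible by the pullback of `y`. -/
theorem hasLinearSyzygy_of_vertex [Infinite F] {q a b : Fin 3 → MvPolynomial σ F}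
    {x y : MvPolynomial σ F} (hx : x.IsHomogeneous 1) (hb : ∀ i, (b i).IsHomogeneous 1)
    (hq : ∀ i, q i = x * a i + y * b i) {w : σ → F}
    (hw : ∀ i u (r : F), eval (u + r • w) (q i) = eval u (q i) + r ^ 2 * eval w (q i))
    (hxw : eval w x ≠ 0) : HasLinearSyzygy q := by
  obtain ⟨ξ, rfl⟩ := hx.exists_eq_linForm
  rw [eval_linForm] at hxw
  have : Nonempty σ := by
    by_contra h
    rw [not_nonempty_iff] at h
    exact hxw (by rw [Subsingleton.elim w 0, map_zero])
  let e : (σ → F) →ₗ[F] (σ → F) := LinearMap.id - ((ξ w)⁻¹ • ξ).smulRight w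
  have he : ∀ v, e v = v + (- ((ξ w)⁻¹ * ξ v)) • w := fun v => by
    simp [e, sub_eq_add_neg]
  have hex : coordHom e (linForm ξ) = 0 := by
    rw [coordHom_linForm, linForm_eq_zero]
    refine LinearMap.ext fun v => ?_
    rw [LinearMap.comp_apply, he]
    simp only [map_add, map_smul, smul_eq_mul, LinearMap.zero_apply]
    field_simp
    ring
  refine hasLinearSyzygy_of_pencil (z := coordHom e y) (b := fun i => coordHom e (b i))
    (fun i => eval w (q i)) (fun i => (hb i).map_algHom (coordHom_X_isHomogeneous e)) fun c hc => ?_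
  have h1 : coordHom e (∑ i, C (c i) * q i) = ∑ i, C (c i) * q i := by
    refine MvPolynomial.funext fun v => ?_
    rw [eval_coordHom, he]
    simp only [map_sum, map_mul, eval_C, hw, mul_add, Finset.sum_add_distrib]
    rw [add_eq_left]
    calc _ = (- ((ξ w)⁻¹ * ξ v)) ^ 2 * ∑ i, c i * eval w (q i) := by
          rw [Finset.mul_sum]; exact Finset.sum_congr rfl fun i _ => by ring
      _ = 0 := by rw [hc, mul_zero]
  rw [← h1, map_sum, Finset.mul_sum]
  refine Finset.sum_congr rfl fun i _ => ?_
  rw [hq i, map_mul, map_add, map_mul, map_mul, hex, algHom_C, algebraMap_eq]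
  ring

end Vertex

/-! ### Descent of the eight linear forms -/

section Descent

variable {k K σ : Type*} [Field k] [Field K] [Algebra k K] [Fintype σ] [DecidableEq σ]

theorem coordHom_mem_adjoin {r : ℕ} (ξ : Fin r → Module.Dual k (σ → k)) (u : Fin r → σ → k)
    (p : MvPolynomial σ k) : coordHom (∑ j, (ξ j).smulRight (u j)) p ∈
      Algebra.adjoin k (Set.range fun j => linForm (ξ j)) := by
  induction p using MvPolynomial.induction_on with
  | C a => rw [algHom_C]; exact Subalgebra.algebraMap_mem _ a
  | add p q hp hq => rw [map_add]; exact add_mem hp hq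
  | mul_X p s hp =>
    rw [map_mul]
    refine mul_mem hp ?_
    have : LinearMap.proj s ∘ₗ (∑ j, (ξ j).smulRight (u j)) = ∑ j, u j s • ξ j := by
      refine LinearMap.ext fun v => ?_
      simp [mul_comm]
    rw [coordHom_X, this, linForm_sum_smul]
    refine sum_mem fun j _ => mul_mem (Subalgebra.algebraMap_mem _ (u j s)) ?_
    exact Algebra.subset_adjoin ⟨j, rfl⟩

omit [Fintype σ] [DecidableEq σ] in
theorem ExpressibleInLinearForms.mono {ι : Type*} {q : ι → MvPolynomial σ k} {r m : ℕ}
    (h : ExpressibleInLinearForms q r) (hrm : r ≤ m) : ExpressibleInLinearForms q m := by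
  obtain ⟨l, hl, hq⟩ := h
  refine ⟨fun j => if h : (j : ℕ) < r then l ⟨j, h⟩ else 0, fun j => ?_, fun i => ?_⟩
  · dsimp only
    split_ifs
    · exact hl _
    · exact isHomogeneous_zero _ _ _
  · refine Algebra.adjoin_mono ?_ (hq i)
    rintro _ ⟨j, rfl⟩
    exact ⟨Fin.castLE hrm j, by simp⟩

theorem hasLinearSyzygy_or_expressible_of_map_inTwoLinearForms [Infinite K]
    {q : Fin 3 → MvPolynomial σ k} (hq : ∀ i, (q i).IsHomogeneous 2)
    (h : InTwoLinearForms fun i => MvPolynomial.map (algebraMap k K) (q i)) :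
    HasLinearSyzygy q ∨ ExpressibleInLinearForms q 8 := by
  obtain ⟨x, y, a, b, hx, hy, ha, hb, hxy⟩ := h
  choose c hc using fun i => (hq i).exists_eq_sum_X_mul_X
  let cK : Fin 3 → Matrix σ σ K := fun i => (c i).map (algebraMap k K)
  have hcK : ∀ i, MvPolynomial.map (algebraMap k K) (q i) =
      ∑ s, ∑ t, C (cK i s t) * (X s * X t) := by
    intro i; conv_lhs => rw [hc i]
    simp [cK]
  -- The three polar matrices stacked; the kernel is the common radical of the polar forms and is
  -- defined over `k`.
  let H : Matrix (Fin 3 × σ) σ k := Matrix.of fun p t => (c p.1 + (c p.1).transpose) p.2 t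
  let HK : Matrix (Fin 3 × σ) σ K := H.map (algebraMap k K)
  have hHK : ∀ w : σ → K, HK.mulVec w = 0 ↔ ∀ i, (cK i + (cK i).transpose).mulVec w = 0 := by
    intro w
    have hrow : ∀ i s, HK.mulVec w (i, s) = (cK i + (cK i).transpose).mulVec w s := by
      intro i s
      simp [HK, H, cK, Matrix.mulVec, dotProduct]
    constructor
    · intro h i
      funext s
      rw [← hrow, h]; rfl
    · intro h
      funext ⟨i, s⟩
      rw [hrow, h]; rfl
  have hpolar : ∀ w : σ → K, HK.mulVec w = 0 → ∀ i u (r : K),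
      eval (u + r • w) (MvPolynomial.map (algebraMap k K) (q i)) =
      eval u (MvPolynomial.map (algebraMap k K) (q i)) +
        r ^ 2 * eval w (MvPolynomial.map (algebraMap k K) (q i)) := by
    intro w hw i u r
    rw [hcK, eval_add_smul_sum_X_mul_X, (hHK w).1 hw i]
    simp
  by_cases hw : ∃ w : σ → K, HK.mulVec w = 0 ∧ (eval w x ≠ 0 ∨ eval w y ≠ 0)
  · left
    obtain ⟨w, hw, hw'⟩ := hw
    apply HasLinearSyzygy.of_map (K := K)
    rcases hw' with h | h
    · exact hasLinearSyzygy_of_vertex hx hb hxy (hpolar w hw) h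
    · exact hasLinearSyzygy_of_vertex hy ha (fun i => (hxy i).trans (add_comm _ _)) (hpolar w hw) h
  right
  push Not at hw
  have hvert : ∀ w : σ → K, HK.mulVec w = 0 → ∀ i u,
      eval (u + w) (MvPolynomial.map (algebraMap k K) (q i)) =
      eval u (MvPolynomial.map (algebraMap k K) (q i)) := by
    intro w h0 i u
    have h1 : eval w (MvPolynomial.map (algebraMap k K) (q i)) = 0 := by
      have := hxy i
      dsimp only at this
      rw [this]
      simp [hw w h0]
    have := hpolar w h0 i u 1
    rwa [h1, one_smul, mul_zero, add_zero] at this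
  -- The common zeros of the eight forms `x`, `y`, `a i`, `b i` lie in the kernel over `K`.
  have hrank : H.rank ≤ 8 := by
    refine (H.rank_le_rank_map (K := K)).trans ?_
    choose α hα using fun i => (ha i).exists_eq_linForm
    choose β hβ using fun i => (hb i).exists_eq_linForm
    obtain ⟨ξ, rfl⟩ := hx.exists_eq_linForm
    obtain ⟨η, rfl⟩ := hy.exists_eq_linForm
    let Λ : (σ → K) →ₗ[K] (Fin 8 → K) :=
      LinearMap.pi ![ξ, η, α 0, α 1, α 2, β 0, β 1, β 2]
    have hle : LinearMap.ker Λ ≤ LinearMap.ker HK.mulVecLin := by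
      intro w hw
      have hΛ : ∀ j, (![ξ, η, α 0, α 1, α 2, β 0, β 1, β 2] : Fin 8 → _) j w = 0 :=
        fun j => congrFun (LinearMap.mem_ker.1 hw) j
      have hξ : ξ w = 0 := hΛ 0
      have hη : η w = 0 := hΛ 1
      have hα0 : ∀ i, α i w = 0 := by
        intro i; fin_cases i
        · exact hΛ 2
        · exact hΛ 3
        · exact hΛ 4
      have hβ0 : ∀ i, β i w = 0 := by
        intro i; fin_cases i
        · exact hΛ 5
        · exact hΛ 6
        · exact hΛ 7
      rw [LinearMap.mem_ker, Matrix.mulVecLin_apply, hHK]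
      intro i
      have hev : ∀ u, eval u (MvPolynomial.map (algebraMap k K) (q i)) =
          ξ u * α i u + η u * β i u := by
        intro u
        have := hxy i
        dsimp only at this
        rw [this, hα i, hβ i]
        simp [eval_linForm]
      rw [← dotProduct_eq_zero_iff]
      intro u
      have h1 := eval_add_smul_sum_X_mul_X (cK i) u w 1
      rw [← hcK, hev, hev, hev] at h1
      simp [hξ, hη, hα0, hβ0] at h1
      rw [dotProduct_comm]
      simpa using h1
    have h1 := Λ.finrank_range_add_finrank_ker
    have h2 := HK.mulVecLin.finrank_range_add_finrank_ker
    have h3 := Submodule.finrank_mono hle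
    have h4 : Module.finrank K (LinearMap.range Λ) ≤ 8 := by
      simpa using Submodule.finrank_le (LinearMap.range Λ)
    change Module.finrank K (LinearMap.range HK.mulVecLin) ≤ 8
    omega
  refine ExpressibleInLinearForms.mono (r := H.rank) ?_ hrank
  let B := Module.finBasis k (LinearMap.range H.mulVecLin)
  obtain ⟨G, hG⟩ := LinearMap.exists_rightInverse_of_surjective H.mulVecLin.rangeRestrict
    H.mulVecLin.range_rangeRestrict
  let ξ : Fin H.rank → Module.Dual k (σ → k) := fun j => B.coord j ∘ₗ H.mulVecLin.rangeRestrict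
  let u : Fin H.rank → σ → k := fun j => G (B j)
  refine ⟨fun j => linForm (ξ j), fun j => linForm_isHomogeneous _, fun i => ?_⟩
  -- The map `π` is a section of `H` composed with `H`: it factors through `H.rank` functionals and
  -- moves vectors only by elements of the kernel.
  let π : (σ → k) →ₗ[k] (σ → k) := ∑ j, (ξ j).smulRight (u j)
  have hπ : ∀ v, H.mulVec (v - π v) = 0 := by
    intro v
    have h1 : π v = G (H.mulVecLin.rangeRestrict v) := by
      conv_rhs => rw [← B.sum_repr (H.mulVecLin.rangeRestrict v), map_sum]
      simp only [π, ξ, u, LinearMap.sum_apply, LinearMap.smulRight_apply, map_smul]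
      rfl
    have h2 : H.mulVecLin (π v) = H.mulVecLin v := by
      rw [h1]
      exact congrArg Subtype.val (LinearMap.congr_fun hG (H.mulVecLin.rangeRestrict v))
    rw [Matrix.mulVec_sub, sub_eq_zero]
    exact h2.symm
  -- Checked on values over the infinite field `K`, since `k` may be finite: `v - v'` lies in the
  -- kernel over `K`, along which the quadrics are translation invariant.
  have key : coordHom π (q i) = q i := by
    apply map_injective (algebraMap k K) (algebraMap k K).injective
    refine MvPolynomial.funext fun v => ?_
    let M : Matrix σ σ k := LinearMap.toMatrix' π
    have hHM : H * M = H := by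
      apply Matrix.toLin'.injective
      refine LinearMap.ext fun v => ?_
      rw [Matrix.toLin'_mul, Matrix.toLin'_toMatrix', LinearMap.comp_apply, Matrix.toLin'_apply,
        Matrix.toLin'_apply]
      have := hπ v
      rw [Matrix.mulVec_sub, sub_eq_zero] at this
      exact this.symm
    have hHMK : HK * M.map (algebraMap k K) = HK := by
      rw [← Matrix.map_mul, hHM]
    set v' := (M.map (algebraMap k K)).mulVec v with hv'
    have hker : HK.mulVec (v - v') = 0 := by
      rw [Matrix.mulVec_sub, hv', Matrix.mulVec_mulVec, hHMK, sub_self]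
    have hev : ∀ p, eval v (MvPolynomial.map (algebraMap k K) (coordHom π p)) =
        eval v' (MvPolynomial.map (algebraMap k K) p) := by
      intro p
      induction p using MvPolynomial.induction_on with
      | C a => simp [algHom_C]
      | add p q hp hq => simp [hp, hq]
      | mul_X p s hp =>
        simp only [map_mul, hp, coordHom_X, map_X, eval_X]
        congr 1
        simp [linForm, hv', Matrix.mulVec, dotProduct, M, LinearMap.toMatrix'_apply]
    rw [hev, ← hvert (v - v') hker i v', add_sub_cancel]
  rw [← key]
  exact coordHom_mem_adjoin ξ u (q i)

end Descent

/-! ### The theorem over an arbitrary field -/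

theorem mainTheorem5 {k : Type*} [Field k] (n : ℕ) (q : Fin 3 → MvPolynomial (Fin n) k)
    (hq : ∀ i, (q i).IsHomogeneous 2)
    (hmin : MinimallyGenerates q (Ideal.span (Set.range q)))
    (hht : (Ideal.span (Set.range q)).height ≤ 2) :
    ExpressibleInLinearForms q 8 ∨
      ∃ q' : Fin 3 → MvPolynomial (Fin n) k, (∀ i, (q' i).IsHomogeneous 2) ∧
        MinimallyGenerates q' (Ideal.span (Set.range q)) ∧
        ShareLinearFactor (q' 0) (q' 1) := by
  have hli := hmin.linearIndependent
  suffices h : HasLinearSyzygy q ∨ ExpressibleInLinearForms q 8 by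
    rcases h with h | h
    · exact h.expressible_or_shareLinearFactor hq hli
    · exact Or.inl h
  obtain ⟨Q, hQ, hQht, hQmem⟩ := exists_prime_height_le_map_mem (K := AlgebraicClosure k)
    (n := 2) (by exact_mod_cast hht)
  rcases hasLinearSyzygy_or_inTwoLinearForms
    (q := fun i => MvPolynomial.map (algebraMap k (AlgebraicClosure k)) (q i))
    (fun i => (hq i).map _) Q (by exact_mod_cast hQht)
    (fun i => hQmem _ (Ideal.subset_span ⟨i, rfl⟩))
    (fun i => (hli.mvPolynomial_map (K := AlgebraicClosure k)).ne_zero i) with h | h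
  · exact Or.inl h.of_map
  · exact hasLinearSyzygy_or_expressible_of_map_inTwoLinearForms hq h
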